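/- Let $m,n\in\mathbb{N}$, let $x_1,\dots,x_m\in\mathbb{R}^3$ be pairwise distinct, and let $$H=-\Delta\otimes I_n,\qquad \operatorname{dom}(H)=\{f\in W^2_2(\mathbb{R}^3,\mathbb{C}^n): f(x_j)=0,\ j=1,\dots,m\}$$ be the minimal Schrödinger operator in $L^2(\mathbb{R}^3,\mathbb{C}^n)$ (where $f(x_j)$ is the value of the continuous representative of $f$). Put $\mathcal H=\bigoplus_{j=1}^m\mathbb{C}^n$ and, for $f\in\operatorname{dom}(H^*)$ (represented by a function that is continuous on $\mathbb{R}^3\setminus\{x_1,\dots,x_m\}$), $$\Gamma_0f=4\pi\{\xi_{0j}\}_{j=1}^m,\quad \xi_{0j}=\lim_{x\to x_j}|x-x_j|f(x),\qquad \Gamma_1f=\Bigl\{\lim_{x\to x_j}\Bigl(f(x)-\frac{\xi_{0j}}{|x-x_j|}\Bigr)\Bigr\}_{j=1}^m .$$ These limits exist, and $\Pi=\{\mathcal H,\Gamma_0,\Gamma_1\}$ is a boundary triplet for $H^*$; that is, $H$ is closed, densely defined and symmetric, $\Gamma_0,\Gamma_1$ are linear, $$(H^*f,g)-(f,H^*g)=(\Gamma_1f,\Gamma_0g)-(\Gamma_0f,\Gamma_1g),\qquad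 f,g\in\operatorname{dom}(H^*),$$ and $(\Gamma_0,\Gamma_1):\operatorname{dom}(H^*)\to\mathcal H\oplus\mathcal H$ is surjective. Let $H_0=H^*\upharpoonright\ker\Gamma_0$, $\mathcal N_z=\ker(H^*-z)$, and for $z\in\rho(H_0)$ let $\gamma(z)=(\Gamma_0\upharpoonright\mathcal N_z)^{-1}$ and $M(z)=\Gamma_1\gamma(z)$ be the $\gamma$-field and the Weyl function of $\Pi$. Let $\sqrt z$ be the square root with $\operatorname{Im}\sqrt z>0$. Then every $z\in\mathbb{C}$ with $\operatorname{Im}z>0$ belongs to $\rho(H_0)$, and for every such $z$: (i) $M(z)=\bigoplus_{s=1}^nM_s(z)$ with respect to the $n$ components of $\mathbb{C}^n$, where $$M_s(z)=\Bigl(\frac{i\sqrt z}{4\pi}\delta_{jk}+\widetilde G_{\sqrt z}(x_j-x_k)\Bigr)_{j,k=1}^m,\qquad \widetilde G_{\sqrt z}(x)=\begin{cases}\dfrac{e^{i\sqrt z|x|}}{4\pi|x|},&x\neq0,\\[1ex]0,&x=0;\end{cases}$$ (ii) for all $\xi=\{\xi_j\}_{j=1}^m$ with $\xi_j\in\mathbb{C}^n$,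 $$(\gamma(z)\xi)(x)=\sum_{j=1}^m\xi_j\,\frac{e^{i\sqrt z|x-x_j|}}{4\pi|x-x_j|}\qquad\text{for almost every }x\in\mathbb{R}^3 .$$ -/

import Mathlib

open MeasureTheory Filter Topology
open scoped ENNReal SchwartzMap

noncomputable section

namespace PointInteraction

section Abstract

variable {𝔥 : Type*} [NormedAddCommGroup 𝔥] [InnerProductSpace ℂ 𝔥]

/-- The resolvent set of a (possibly unbounded) operator `T`: those `z` for which `T - z` maps the
domain of `T` bijectively onto the whole space, with an everywhere defined bounded inverse `R`. -/
def resolventSet (T : 𝔥 →ₗ.[ℂ] 𝔥) : Set ℂ :=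
  {z | ∃ R : 𝔥 →L[ℂ] 𝔥,
    (∀ g : 𝔥, ∃ h : R g ∈ T.domain, T ⟨R g, h⟩ - z • R g = g) ∧
    ∀ f : T.domain, R (T f - z • (f : 𝔥)) = f}

variable [CompleteSpace 𝔥]

/-- The defect subspace `𝒩_z = ker (A* - z)`, as a subspace of `dom A*`. -/
def defectSubspace (A : 𝔥 →ₗ.[ℂ] 𝔥) (z : ℂ) : Submodule ℂ A.adjoint.domain :=
  LinearMap.ker (A.adjoint.toFun - z • A.adjoint.domain.subtype)

/-- A boundary triplet `{𝓗, Γ₀, Γ₁}` for the adjoint of a densely defined closed symmetric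
operator `A`: linear maps on `dom A*` that satisfy the second Green identity and are jointly onto.
(That the deficiency indices of `A` agree is then automatic.) -/
structure BoundaryTriplet (A : 𝔥 →ₗ.[ℂ] 𝔥)
    (𝓗 : Type*) [NormedAddCommGroup 𝓗] [InnerProductSpace ℂ 𝓗] where
  dense_domain : Dense (A.domain : Set 𝔥)
  isClosed : A.IsClosed
  symmetric : A.IsFormalAdjoint A
  Γ₀ : A.adjoint.domain →ₗ[ℂ] 𝓗
  Γ₁ : A.adjoint.domain →ₗ[ℂ] 𝓗
  green : ∀ f g : A.adjoint.domain,
    inner ℂ (A.adjoint f) (g : 𝔥) - inner ℂ (f : 𝔥) (A.adjoint g) =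
      inner ℂ (Γ₁ f) (Γ₀ g) - inner ℂ (Γ₀ f) (Γ₁ g)
  surjective : Function.Surjective fun f : A.adjoint.domain => (Γ₀ f, Γ₁ f)

namespace BoundaryTriplet

variable {A : 𝔥 →ₗ.[ℂ] 𝔥} {𝓗 : Type*} [NormedAddCommGroup 𝓗] [InnerProductSpace ℂ 𝓗]

/-- The extension `A₀`, the restriction of `A*` to `ker Γ₀`. -/
def A₀ (P : BoundaryTriplet A 𝓗) : 𝔥 →ₗ.[ℂ] 𝔥 :=
  A.adjoint.domRestrict ((LinearMap.ker P.Γ₀).map A.adjoint.domain.subtype)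

/-- The restriction of `Γ₀` to `𝒩_z`. -/
def Γ₀Restrict (P : BoundaryTriplet A 𝓗) (z : ℂ) : defectSubspace A z →ₗ[ℂ] 𝓗 :=
  P.Γ₀.domRestrict (defectSubspace A z)

/-- `Γ₀` restricted to `𝒩_z` is a bijection onto `𝓗` when `z` is in the resolvent set of `A₀`. -/
theorem bijective_Γ₀Restrict (P : BoundaryTriplet A 𝓗) {z : ℂ} (hz : z ∈ resolventSet P.A₀) :
    Function.Bijective (P.Γ₀Restrict z) := by
  obtain ⟨R, hR, hR'⟩ := hz
  constructor
  · rw [injective_iff_map_eq_zero]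
    intro f hf
    have hmem : ((f : A.adjoint.domain) : 𝔥) ∈ P.A₀.domain :=
      ⟨⟨f, hf, rfl⟩, (f : A.adjoint.domain).2⟩
    have h1 : P.A₀ ⟨_, hmem⟩ = A.adjoint (f : A.adjoint.domain) :=
      LinearPMap.domRestrict_apply rfl
    have h2 : A.adjoint (f : A.adjoint.domain) - z • ((f : A.adjoint.domain) : 𝔥) = 0 := f.2
    have h3 := hR' ⟨_, hmem⟩
    rw [h1, h2, map_zero] at h3
    exact Subtype.ext (Subtype.ext h3.symm)
  · intro ξ
    obtain ⟨f, hf⟩ := P.surjective (ξ, 0)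
    have hf0 : P.Γ₀ f = ξ := congrArg Prod.fst hf
    obtain ⟨h, hg⟩ := hR (A.adjoint f - z • (f : 𝔥))
    obtain ⟨⟨u, hu, hu'⟩, -⟩ := id h
    have h1 : P.A₀ ⟨_, h⟩ = A.adjoint u := LinearPMap.domRestrict_apply hu'.symm
    rw [h1, ← hu'] at hg
    have hN : f - u ∈ defectSubspace A z := by
      have : A.adjoint (f - u) - z • ((f - u : A.adjoint.domain) : 𝔥) = 0 := by
        have hg' : A.adjoint u - z • (u : 𝔥) = A.adjoint f - z • (f : 𝔥) := hg
        rw [LinearPMap.map_sub, Submodule.coe_sub, smul_sub, sub_sub_sub_comm, hg', sub_self]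
      exact this
    refine ⟨⟨f - u, hN⟩, ?_⟩
    change P.Γ₀ (f - u) = ξ
    rw [map_sub, hf0, LinearMap.mem_ker.1 hu, sub_zero]

/-- The `γ`-field at a point `z` of the resolvent set of `A₀`: the inverse of `Γ₀` restricted
to `𝒩_z`, as a map into the Hilbert space. -/
def gammaField (P : BoundaryTriplet A 𝓗) (z : ℂ) (hz : z ∈ resolventSet P.A₀) : 𝓗 →ₗ[ℂ] 𝔥 :=
  A.adjoint.domain.subtype ∘ₗ (defectSubspace A z).subtype ∘ₗ
    (LinearEquiv.ofBijective (P.Γ₀Restrict z) (P.bijective_Γ₀Restrict hz)).symm.toLinearMap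

/-- The Weyl function `M(z) = Γ₁ γ(z)` at a point `z` of the resolvent set of `A₀`. -/
def weylFunction (P : BoundaryTriplet A 𝓗) (z : ℂ) (hz : z ∈ resolventSet P.A₀) : 𝓗 →ₗ[ℂ] 𝓗 :=
  P.Γ₁ ∘ₗ (defectSubspace A z).subtype ∘ₗ
    (LinearEquiv.ofBijective (P.Γ₀Restrict z) (P.bijective_Γ₀Restrict hz)).symm.toLinearMap

end BoundaryTriplet

end Abstract

/-- The space `ℝ³`. -/
abbrev Space : Type := EuclideanSpace ℝ (Fin 3)

/-- The Hilbert space `L²(ℝ³, ℂⁿ)`. -/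
abbrev L2 (n : ℕ) : Type := Lp (EuclideanSpace ℂ (Fin n)) 2 (volume : Measure Space)

/-- The boundary space `⊕_{j=1}^m ℂⁿ`. -/
abbrev BoundarySpace (m n : ℕ) : Type := PiLp 2 fun _ : Fin m => EuclideanSpace ℂ (Fin n)

open scoped Laplacian

/-- The Sobolev space `W²₂(ℝ³, ℂⁿ)`, as a subspace of `L²(ℝ³, ℂⁿ)`. -/
def W22 (n : ℕ) : Submodule ℂ (L2 n) where
  carrier := {f | TemperedDistribution.MemSobolev 2 2
    (f : 𝓢'(Space, EuclideanSpace ℂ (Fin n)))}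
  zero_mem' := by
    change TemperedDistribution.MemSobolev 2 2 _
    rw [← Lp.toTemperedDistributionCLM_apply, map_zero]
    exact TemperedDistribution.memSobolev_fun_zero _ _ 2 2
  add_mem' {f g} hf hg := by
    change TemperedDistribution.MemSobolev 2 2 _
    rw [← Lp.toTemperedDistributionCLM_apply, map_add]
    exact TemperedDistribution.MemSobolev.add hf hg
  smul_mem' c f hf := by
    change TemperedDistribution.MemSobolev 2 2 _
    rw [← Lp.toTemperedDistributionCLM_apply, map_smul]
    exact TemperedDistribution.MemSobolev.smul c hf

/-- The distributional Laplacian of a `W²₂` function is an `L²` function. -/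
theorem exists_neg_laplacian {n : ℕ} (f : W22 n) :
    ∃ g : L2 n, (g : 𝓢'(Space, EuclideanSpace ℂ (Fin n))) =
      -Δ ((f : L2 n) : 𝓢'(Space, EuclideanSpace ℂ (Fin n))) := by
  have h := TemperedDistribution.MemSobolev.laplacian (s := 2) f.2
  rw [sub_self, TemperedDistribution.memSobolev_zero_iff] at h
  obtain ⟨g, hg⟩ := h
  refine ⟨-g, ?_⟩
  rw [hg, ← Lp.toTemperedDistributionCLM_apply, ← Lp.toTemperedDistributionCLM_apply, map_neg]

/-- An `L²` function is determined by the distribution it defines. -/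
theorem toTemperedDistribution_inj {n : ℕ} {f g : L2 n}
    (h : (f : 𝓢'(Space, EuclideanSpace ℂ (Fin n))) = g) : f = g := by
  rw [← Lp.toTemperedDistributionCLM_apply, ← Lp.toTemperedDistributionCLM_apply] at h
  exact LinearMap.ker_eq_bot.1 (Lp.ker_toTemperedDistributionCLM_eq_bot
    (F := EuclideanSpace ℂ (Fin n)) (μ := (volume : Measure Space)) (p := 2)) h

/-- `-Δ f` as an `L²` function, for `f` in `W²₂`. -/
def negLaplacianFun {n : ℕ} (f : W22 n) : L2 n := (exists_neg_laplacian f).choose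

theorem negLaplacianFun_spec {n : ℕ} (f : W22 n) :
    Lp.toTemperedDistributionCLM (EuclideanSpace ℂ (Fin n)) (volume : Measure Space) 2
        (negLaplacianFun f) =
      -LineDeriv.laplacianCLM ℂ Space 𝓢'(Space, EuclideanSpace ℂ (Fin n))
        (Lp.toTemperedDistributionCLM (EuclideanSpace ℂ (Fin n)) (volume : Measure Space) 2
          (f : L2 n)) := by
  rw [TemperedDistribution.laplacianCLM_apply]
  exact (exists_neg_laplacian f).choose_spec

/-- The operator `-Δ ⊗ I_n` from `W²₂(ℝ³, ℂⁿ)` to `L²(ℝ³, ℂⁿ)`, in the sense of distributions. -/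
def negLaplacian (n : ℕ) : W22 n →ₗ[ℂ] L2 n where
  toFun f := negLaplacianFun f
  map_add' f g := by
    apply toTemperedDistribution_inj
    rw [← Lp.toTemperedDistributionCLM_apply, ← Lp.toTemperedDistributionCLM_apply, map_add]
    simp only [negLaplacianFun_spec, Submodule.coe_add, map_add, neg_add]
  map_smul' c f := by
    apply toTemperedDistribution_inj
    rw [← Lp.toTemperedDistributionCLM_apply, ← Lp.toTemperedDistributionCLM_apply, map_smul]
    simp only [negLaplacianFun_spec, Submodule.coe_smul, map_smul, RingHom.id_apply, smul_neg]

variable {m n : ℕ}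

/-- The domain of the minimal operator: all `f ∈ W²₂(ℝ³, ℂⁿ)` whose continuous representative
vanishes at the points `x_j`. -/
def minimalDomain (n : ℕ) (x : Fin m → Space) : Submodule ℂ (L2 n) where
  carrier := {f | f ∈ W22 n ∧ ∃ u : Space → EuclideanSpace ℂ (Fin n),
    Continuous u ∧ f =ᵐ[volume] u ∧ ∀ j, u (x j) = 0}
  zero_mem' := ⟨zero_mem _, 0, continuous_zero, Lp.coeFn_zero _ _ _, fun _ => rfl⟩
  add_mem' := by
    rintro f g ⟨hf, u, hu, hfu, hux⟩ ⟨hg, v, hv, hgv, hvx⟩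
    refine ⟨add_mem hf hg, u + v, hu.add hv, (Lp.coeFn_add f g).trans (hfu.add hgv), fun j => ?_⟩
    rw [Pi.add_apply, hux, hvx, add_zero]
  smul_mem' := by
    rintro c f ⟨hf, u, hu, hfu, hux⟩
    refine ⟨Submodule.smul_mem _ c hf, c • u, hu.const_smul c,
      (Lp.coeFn_smul c f).trans (hfu.const_smul c), fun j => ?_⟩
    rw [Pi.smul_apply, hux, smul_zero]

theorem minimalDomain_le (n : ℕ) (x : Fin m → Space) : minimalDomain n x ≤ W22 n :=
  fun _ hf => hf.1

/-- The minimal Schrödinger operator `H = -Δ ⊗ I_n` in `L²(ℝ³, ℂⁿ)`. -/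
def minimalOperator (n : ℕ) (x : Fin m → Space) : L2 n →ₗ.[ℂ] L2 n where
  domain := minimalDomain n x
  toFun := negLaplacian n ∘ₗ Submodule.inclusion (minimalDomain_le n x)

/-- `h₀` and `h₁` are the boundary values of `f` at the points `x_j`: with `u` the representative
of `f` that is continuous away from these points, and
`ξ_{0j} = lim_{y → x_j} |y - x_j| u(y)`, one has `h_{0j} = 4π ξ_{0j}` and
`h_{1j} = lim_{y → x_j} (u(y) - ξ_{0j} / |y - x_j|)`. -/
def HasBoundaryValues (x : Fin m → Space) (f : L2 n) (h₀ h₁ : BoundarySpace m n) : Prop :=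
  ∃ u : Space → EuclideanSpace ℂ (Fin n),
    f =ᵐ[volume] u ∧ ContinuousOn u (Set.range x)ᶜ ∧
    ∃ ξ₀ : Fin m → EuclideanSpace ℂ (Fin n), ∀ j,
      Tendsto (fun y => ‖y - x j‖ • u y) (𝓝[≠] x j) (𝓝 (ξ₀ j)) ∧
      h₀ j = (4 * Real.pi) • ξ₀ j ∧
      Tendsto (fun y => u y - ‖y - x j‖⁻¹ • ξ₀ j) (𝓝[≠] x j) (𝓝 (h₁ j))

/-- The boundary triplet with `Γ₀` and `Γ₁` given by the boundary values at the points `x_j`. -/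
def IsPointTriplet (x : Fin m → Space)
    (P : BoundaryTriplet (minimalOperator n x) (BoundarySpace m n)) : Prop :=
  ∀ f : (minimalOperator n x).adjoint.domain, HasBoundaryValues x (f : L2 n) (P.Γ₀ f) (P.Γ₁ f)

/-- The branch of the square root on `ℂ \ [0, ∞)` with values in the upper half-plane. -/
def sqrtUpper (z : ℂ) : ℂ := Complex.I * (-z) ^ (1 / 2 : ℂ)

/-- `e^{i √z |y|} / (4π |y|)` for `y ≠ 0`, and `0` for `y = 0`. -/
def greenTilde (z : ℂ) (y : Space) : ℂ :=
  if y = 0 then 0 else Complex.exp (Complex.I * sqrtUpper z * ‖y‖) / (4 * Real.pi * ‖y‖)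

/-- The `m × m` matrix `M_s(z)` (the same for every `s`). -/
def weylBlock (x : Fin m → Space) (z : ℂ) : Matrix (Fin m) (Fin m) ℂ :=
  Matrix.of fun j k =>
    Complex.I * sqrtUpper z / (4 * Real.pi) * (if j = k then 1 else 0) + greenTilde z (x j - x k)

end PointInteraction

end

/-!
Fourier inversion turns the value at `a` of a function `f ∈ W²₂(ℝ³, ℂⁿ)` into the inner product of
`(-Δ - z̄) f` with the Green function `G(· - a)`, where `G(y) = e^{-κ|y|} / (4π|y|)`, `z = -κ²` and
`Re κ > 0`. Hence the minimal operator is the restriction of the self-adjoint operator `-Δ` to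
those `f` for which `(-Δ - z̄) f` is orthogonal to finitely many Green functions, and these span
`ker (H* - z)`. Consequently every element of `dom H*` is a sum `f + ∑_j G(· - x_j) ξ_j` with
`f ∈ W²₂`, and the expansion `G(y) = 1 / (4π|y|) - κ / (4π) + o(1)` at `0` shows that its boundary
values are `ξ` and `(f(x_j))_j` plus the Weyl matrix applied to `ξ`.
-/

noncomputable section

namespace PointInteraction

section TraceRestriction

open ComplexConjugate

variable {𝔥 𝓗 : Type*} [NormedAddCommGroup 𝔥] [InnerProductSpace ℂ 𝔥]
  [NormedAddCommGroup 𝓗] [InnerProductSpace ℂ 𝓗]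

/-- `A` is the restriction of the operator `S` to the kernel of the trace map `τ`. -/
structure IsTraceRestriction (A S : 𝔥 →ₗ.[ℂ] 𝔥) (τ : S.domain →ₗ[ℂ] 𝓗) : Prop where
  le : A ≤ S
  mem_domain_iff : ∀ f : S.domain, (f : 𝔥) ∈ A.domain ↔ τ f = 0

/-- `G` represents the trace map `τ` on `dom S` at the spectral parameter `z`, and its values lie
outside `dom S`. For a self-adjoint `S` with restriction `A = S ↾ ker τ`, this makes the range of
`G` the defect subspace `ker (A* - z)`. -/
structure IsGreenMap (S : 𝔥 →ₗ.[ℂ] 𝔥) (τ : S.domain →ₗ[ℂ] 𝓗) (z : ℂ) (G : 𝓗 →ₗ[ℂ] 𝔥) :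
    Prop where
  inner_apply : ∀ (ξ : 𝓗) (f : S.domain),
    inner ℂ (G ξ) (S f - conj z • (f : 𝔥)) = inner ℂ ξ (τ f)
  eq_zero_of_mem_domain : ∀ ξ : 𝓗, G ξ ∈ S.domain → ξ = 0

theorem exists_apply_sub_smul_eq {S : 𝔥 →ₗ.[ℂ] 𝔥} {z : ℂ} (hz : z ∈ resolventSet S) (g : 𝔥) :
    ∃ f : S.domain, S f - z • (f : 𝔥) = g := by
  obtain ⟨R, hR, -⟩ := hz
  exact ⟨⟨R g, (hR g).1⟩, (hR g).2⟩

variable {A S : 𝔥 →ₗ.[ℂ] 𝔥} {τ : S.domain →ₗ[ℂ] 𝓗} {z : ℂ} {G : 𝓗 →ₗ[ℂ] 𝔥}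

namespace IsTraceRestriction

theorem apply_inclusion (hA : IsTraceRestriction A S τ) (v : A.domain) :
    S (Submodule.inclusion hA.le.1 v) = A v :=
  (hA.le.2 rfl).symm

theorem trace_inclusion (hA : IsTraceRestriction A S τ) (v : A.domain) :
    τ (Submodule.inclusion hA.le.1 v) = 0 :=
  (hA.mem_domain_iff _).1 v.2

theorem apply_mk (hA : IsTraceRestriction A S τ) (f : S.domain) (hf : (f : 𝔥) ∈ A.domain) :
    A ⟨f, hf⟩ = S f :=
  hA.le.2 rfl

theorem isFormalAdjoint (hA : IsTraceRestriction A S τ) (hS : S.IsFormalAdjoint S) :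
    A.IsFormalAdjoint A := fun u v => by
  rw [← hA.apply_inclusion, ← hA.apply_inclusion]
  exact hS (Submodule.inclusion hA.le.1 u) (Submodule.inclusion hA.le.1 v)

end IsTraceRestriction

namespace IsGreenMap

theorem inner_apply_sub_smul (hG : IsGreenMap S τ z G) (hA : IsTraceRestriction A S τ) (ξ : 𝓗)
    (v : A.domain) : inner ℂ (G ξ) (A v - conj z • (v : 𝔥)) = 0 := by
  have h := hG.inner_apply ξ (Submodule.inclusion hA.le.1 v)
  rwa [hA.trace_inclusion, hA.apply_inclusion, inner_zero_right] at h

theorem injective (hG : IsGreenMap S τ z G) : Function.Injective G :=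
  (injective_iff_map_eq_zero G).2 fun ξ hξ => hG.eq_zero_of_mem_domain ξ (hξ ▸ zero_mem _)

theorem trace_eq_zero (hG : IsGreenMap S τ z G) {f : S.domain}
    (hf : ∀ ξ, inner ℂ (G ξ) (S f - conj z • (f : 𝔥)) = 0) : τ f = 0 :=
  ext_inner_left ℂ fun ξ => by rw [← hG.inner_apply, hf, inner_zero_right]

theorem isClosed [CompleteSpace 𝔥] (hG : IsGreenMap S τ z G) (hA : IsTraceRestriction A S τ)
    (hz : conj z ∈ resolventSet S) : A.IsClosed := by
  obtain ⟨R, hR, hR'⟩ := hz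
  have hgraph : (A.graph : Set (𝔥 × 𝔥)) = {p | R (p.2 - conj z • p.1) = p.1} ∩
      ⋂ ξ, {p | inner ℂ (G ξ) (p.2 - conj z • p.1) = 0} := by
    ext ⟨u, w⟩
    simp only [SetLike.mem_coe, LinearPMap.mem_graph_iff, Set.mem_inter_iff, Set.mem_iInter,
      Set.mem_ofPred_eq]
    constructor
    · rintro ⟨v, rfl, rfl⟩
      refine ⟨?_, fun ξ => hG.inner_apply_sub_smul hA ξ v⟩
      rw [← hA.apply_inclusion]
      exact hR' (Submodule.inclusion hA.le.1 v)
    · rintro ⟨hu, hw⟩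
      obtain ⟨hdom, hSu⟩ := hR (w - conj z • u)
      obtain ⟨f, rfl⟩ : ∃ f : S.domain, (f : 𝔥) = u := ⟨⟨_, hdom⟩, hu⟩
      have hSf : S f - conj z • (f : 𝔥) = w - conj z • (f : 𝔥) := by
        simpa only [hu] using hSu
      have hf := (hA.mem_domain_iff f).2 (hG.trace_eq_zero fun ξ => by rw [hSf, hw])
      exact ⟨⟨f, hf⟩, rfl, (hA.apply_mk f hf).trans (sub_left_injective hSf)⟩
  change _root_.IsClosed (A.graph : Set (𝔥 × 𝔥))
  rw [hgraph]
  exact (isClosed_eq (by fun_prop) (by fun_prop)).inter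
    (isClosed_iInter fun ξ => isClosed_eq (by fun_prop) continuous_const)

theorem inner_add_smul_apply (hG : IsGreenMap S τ z G) (hA : IsTraceRestriction A S τ)
    (hS : S.IsFormalAdjoint S) (f : S.domain) (ξ : 𝓗) (v : A.domain) :
    inner ℂ (S f + z • G ξ) (v : 𝔥) = inner ℂ ((f : 𝔥) + G ξ) (A v) := by
  have hsymm := hS f (Submodule.inclusion hA.le.1 v)
  have hdefect := hG.inner_apply_sub_smul hA ξ v
  rw [hA.apply_inclusion] at hsymm
  rw [inner_sub_right, inner_smul_right, sub_eq_zero] at hdefect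
  rw [inner_add_left, inner_add_left, inner_smul_left, ← hdefect]
  exact congrArg (· + _) hsymm

theorem add_mem_adjoint_domain [CompleteSpace 𝔥] (hG : IsGreenMap S τ z G)
    (hA : IsTraceRestriction A S τ) (hS : S.IsFormalAdjoint S) (f : S.domain) (ξ : 𝓗) :
    (f : 𝔥) + G ξ ∈ A.adjoint.domain :=
  LinearPMap.mem_adjoint_domain_of_exists _ ⟨_, hG.inner_add_smul_apply hA hS f ξ⟩

section FiniteDimensional

variable [FiniteDimensional ℂ 𝓗]

theorem mem_range (hG : IsGreenMap S τ z G) (hA : IsTraceRestriction A S τ)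
    (hz : conj z ∈ resolventSet S) {g : 𝔥}
    (hg : ∀ v : A.domain, inner ℂ g (A v - conj z • (v : 𝔥)) = 0) : g ∈ LinearMap.range G := by
  rw [← Submodule.orthogonal_orthogonal (LinearMap.range G), Submodule.mem_orthogonal]
  intro u hu
  obtain ⟨f, rfl⟩ := exists_apply_sub_smul_eq hz u
  have hf := (hA.mem_domain_iff f).2
    (hG.trace_eq_zero fun ξ => hu _ (LinearMap.mem_range_self G ξ))
  rw [inner_eq_zero_symm, ← hA.apply_mk f hf]
  exact hg ⟨f, hf⟩

theorem surjective_trace (hG : IsGreenMap S τ z G) (hz : conj z ∈ resolventSet S) :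
    Function.Surjective τ := by
  rw [← LinearMap.range_eq_top, ← Submodule.orthogonal_eq_bot_iff, Submodule.eq_bot_iff]
  intro ξ hξ
  refine hG.injective ?_
  rw [map_zero]
  refine ext_inner_right ℂ fun u => ?_
  obtain ⟨f, rfl⟩ := exists_apply_sub_smul_eq hz u
  rw [hG.inner_apply, inner_zero_left, inner_eq_zero_symm]
  exact hξ _ (LinearMap.mem_range_self τ f)

variable [CompleteSpace 𝔥]

theorem dense_domain (hG : IsGreenMap S τ z G) (hA : IsTraceRestriction A S τ)
    (hS : S.IsFormalAdjoint S) (hz : z ∈ resolventSet S) (hz' : conj z ∈ resolventSet S) :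
    Dense (A.domain : Set 𝔥) := by
  rw [Submodule.dense_iff_topologicalClosure_eq_top, Submodule.topologicalClosure_eq_top_iff,
    Submodule.eq_bot_iff]
  intro g hg
  obtain ⟨f, rfl⟩ := exists_apply_sub_smul_eq hz g
  obtain ⟨ξ, hξ⟩ : (f : 𝔥) ∈ LinearMap.range G := by
    refine hG.mem_range hA hz' fun v => ?_
    have hv : inner ℂ (S f - z • (f : 𝔥)) (v : 𝔥) = 0 := inner_eq_zero_symm.1 (hg v v.2)
    have hsymm : inner ℂ (S f) (v : 𝔥) = inner ℂ (f : 𝔥) (A v) := by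
      rw [← hA.apply_inclusion]
      exact hS f (Submodule.inclusion hA.le.1 v)
    rwa [inner_sub_left, inner_smul_left, ← inner_smul_right, hsymm, ← inner_sub_right] at hv
  have hf : f = 0 := by
    rw [← Subtype.coe_inj, ← hξ, hG.eq_zero_of_mem_domain ξ (hξ ▸ f.2), map_zero,
      ZeroMemClass.coe_zero]
  simp [hf]

theorem adjoint_apply (hG : IsGreenMap S τ z G) (hA : IsTraceRestriction A S τ)
    (hS : S.IsFormalAdjoint S) (hz : z ∈ resolventSet S) (hz' : conj z ∈ resolventSet S)
    {u : A.adjoint.domain} {f : S.domain} {ξ : 𝓗} (hu : (u : 𝔥) = f + G ξ) :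
    A.adjoint u = S f + z • G ξ :=
  LinearPMap.adjoint_apply_eq (hG.dense_domain hA hS hz hz') u fun v => by
    rw [hu, hG.inner_add_smul_apply hA hS]

theorem exists_eq_add (hG : IsGreenMap S τ z G) (hA : IsTraceRestriction A S τ)
    (hS : S.IsFormalAdjoint S) (hz : z ∈ resolventSet S) (hz' : conj z ∈ resolventSet S)
    (u : A.adjoint.domain) : ∃ (f : S.domain) (ξ : 𝓗), (u : 𝔥) = f + G ξ := by
  obtain ⟨f, hf⟩ := exists_apply_sub_smul_eq hz (A.adjoint u - z • (u : 𝔥))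
  obtain ⟨ξ, hξ⟩ : (u : 𝔥) - f ∈ LinearMap.range G := by
    refine hG.mem_range hA hz' fun v => ?_
    have hu := LinearPMap.adjoint_isFormalAdjoint (hG.dense_domain hA hS hz hz') u v
    have hsymm := hS f (Submodule.inclusion hA.le.1 v)
    have hv := congrArg (inner ℂ · (v : 𝔥)) hf
    rw [hA.apply_inclusion] at hsymm
    simp only [inner_sub_left, inner_sub_right, inner_smul_left, inner_smul_right,
      Submodule.coe_inclusion] at hu hsymm hv ⊢
    linear_combination hsymm - hu - hv
  exact ⟨f, ξ, by rw [hξ, add_sub_cancel]⟩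

end FiniteDimensional

end IsGreenMap

end TraceRestriction

section TripletOfGreenMap

open ComplexConjugate

variable {𝔥 𝓗 : Type*} [NormedAddCommGroup 𝔥] [InnerProductSpace ℂ 𝔥] [CompleteSpace 𝔥]
  [NormedAddCommGroup 𝓗] [InnerProductSpace ℂ 𝓗]
  {A S : 𝔥 →ₗ.[ℂ] 𝔥} {τ : S.domain →ₗ[ℂ] 𝓗} {z : ℂ} {G : 𝓗 →ₗ[ℂ] 𝔥} {W : 𝓗 →ₗ[ℂ] 𝓗}

namespace BoundaryTriplet

theorem gammaField_Γ₀ (P : BoundaryTriplet A 𝓗) (hz : z ∈ resolventSet P.A₀)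
    (u : defectSubspace A z) :
    P.gammaField z hz (P.Γ₀ u) = (u : A.adjoint.domain) :=
  congrArg (fun v : defectSubspace A z => ((v : A.adjoint.domain) : 𝔥))
    (LinearEquiv.ofBijective_symm_apply_apply (P.Γ₀Restrict z) u)

theorem weylFunction_Γ₀ (P : BoundaryTriplet A 𝓗) (hz : z ∈ resolventSet P.A₀)
    (u : defectSubspace A z) :
    P.weylFunction z hz (P.Γ₀ u) = P.Γ₁ u :=
  congrArg (fun v : defectSubspace A z => P.Γ₁ v)
    (LinearEquiv.ofBijective_symm_apply_apply (P.Γ₀Restrict z) u)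

/-- The boundary maps of `P` are read off decompositions `u = f + G ξ` with `f ∈ dom S`: `Γ₀ u` is
the coefficient `ξ`, and `Γ₁ u = τ f + W ξ`. -/
def IsGreenTriplet (P : BoundaryTriplet A 𝓗) (τ : S.domain →ₗ[ℂ] 𝓗) (G : 𝓗 →ₗ[ℂ] 𝔥)
    (W : 𝓗 →ₗ[ℂ] 𝓗) : Prop :=
  ∀ (u : A.adjoint.domain) (f : S.domain) (ξ : 𝓗), (u : 𝔥) = f + G ξ →
    P.Γ₀ u = ξ ∧ P.Γ₁ u = τ f + W ξ

variable [FiniteDimensional ℂ 𝓗] {P : BoundaryTriplet A 𝓗}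

namespace IsGreenTriplet

theorem A₀_eq (hP : P.IsGreenTriplet τ G W) (hG : IsGreenMap S τ z G)
    (hA : IsTraceRestriction A S τ) (hS : S.IsFormalAdjoint S) (hz : z ∈ resolventSet S)
    (hz' : conj z ∈ resolventSet S) : P.A₀ = S := by
  have hmem (f : S.domain) : (f : 𝔥) ∈ A.adjoint.domain := by
    simpa using hG.add_mem_adjoint_domain hA hS f 0
  have hmem₀ (f : S.domain) : (f : 𝔥) ∈ P.A₀.domain :=
    ⟨⟨⟨f, hmem f⟩, (hP ⟨f, hmem f⟩ f 0 (by simp)).1, rfl⟩, hmem f⟩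
  symm
  refine LinearPMap.eq_of_le_of_domain_eq ⟨fun f hf => hmem₀ ⟨f, hf⟩, fun f u hfu => ?_⟩
    (le_antisymm (fun f hf => hmem₀ ⟨f, hf⟩) ?_)
  · calc S f = A.adjoint ⟨f, hmem f⟩ := by
          simpa using (hG.adjoint_apply hA hS hz hz' (u := ⟨f, hmem f⟩) (ξ := 0) (by simp)).symm
      _ = P.A₀ u := (LinearPMap.domRestrict_apply (x := u) (y := ⟨f, hmem f⟩) hfu.symm).symm
  · rintro - ⟨⟨u, hu, rfl⟩, -⟩
    obtain ⟨f, ξ, huf⟩ := hG.exists_eq_add hA hS hz hz' u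
    obtain rfl : ξ = 0 := (hP u f ξ huf).1.symm.trans hu
    rw [map_zero, add_zero] at huf
    rw [Submodule.subtype_apply, huf]
    exact f.2

theorem exists_mem_defectSubspace (hP : P.IsGreenTriplet τ G W) (hG : IsGreenMap S τ z G)
    (hA : IsTraceRestriction A S τ) (hS : S.IsFormalAdjoint S) (hz : z ∈ resolventSet S)
    (hz' : conj z ∈ resolventSet S) (ξ : 𝓗) :
    ∃ u : defectSubspace A z, ((u : A.adjoint.domain) : 𝔥) = G ξ ∧ P.Γ₀ u = ξ ∧ P.Γ₁ u = W ξ := by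
  have hmem : G ξ ∈ A.adjoint.domain := by
    simpa using hG.add_mem_adjoint_domain hA hS 0 ξ
  have hadj := hG.adjoint_apply hA hS hz hz' (u := ⟨G ξ, hmem⟩) (f := 0) (ξ := ξ) (by simp)
  rw [LinearPMap.map_zero, zero_add] at hadj
  refine ⟨⟨⟨G ξ, hmem⟩, sub_eq_zero.2 hadj⟩, rfl, ?_⟩
  simpa using hP ⟨G ξ, hmem⟩ 0 ξ (by simp)

theorem gammaField_eq (hP : P.IsGreenTriplet τ G W) (hG : IsGreenMap S τ z G)
    (hA : IsTraceRestriction A S τ) (hS : S.IsFormalAdjoint S) (hz : z ∈ resolventSet S)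
    (hz' : conj z ∈ resolventSet S) (hzP : z ∈ resolventSet P.A₀) : P.gammaField z hzP = G := by
  ext1 ξ
  obtain ⟨u, hu, hu₀, -⟩ := hP.exists_mem_defectSubspace hG hA hS hz hz' ξ
  rw [← hu, ← P.gammaField_Γ₀ hzP u, hu₀]

theorem weylFunction_eq (hP : P.IsGreenTriplet τ G W) (hG : IsGreenMap S τ z G)
    (hA : IsTraceRestriction A S τ) (hS : S.IsFormalAdjoint S) (hz : z ∈ resolventSet S)
    (hz' : conj z ∈ resolventSet S) (hzP : z ∈ resolventSet P.A₀) : P.weylFunction z hzP = W := by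
  ext1 ξ
  obtain ⟨u, -, hu₀, hu₁⟩ := hP.exists_mem_defectSubspace hG hA hS hz hz' ξ
  rw [← hu₁, ← P.weylFunction_Γ₀ hzP u, hu₀]

end IsGreenTriplet

end BoundaryTriplet

namespace IsGreenMap

variable [FiniteDimensional ℂ 𝓗]

theorem existsUnique_eq_add (hG : IsGreenMap S τ z G) (hA : IsTraceRestriction A S τ)
    (hS : S.IsFormalAdjoint S) (hz : z ∈ resolventSet S) (hz' : conj z ∈ resolventSet S)
    (u : A.adjoint.domain) : ∃! p : S.domain × 𝓗, (u : 𝔥) = p.1 + G p.2 := by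
  obtain ⟨f, ξ, hu⟩ := hG.exists_eq_add hA hS hz hz' u
  refine ⟨(f, ξ), hu, fun ⟨g, η⟩ hu' => ?_⟩
  have hdiff : G (η - ξ) = f - g := by
    rw [map_sub, sub_eq_sub_iff_add_eq_add, add_comm, ← hu', hu, add_comm]
  obtain rfl : η = ξ := sub_eq_zero.1 (hG.eq_zero_of_mem_domain _ (hdiff ▸ (f - g).2))
  have hgf : (g : 𝔥) = f := add_right_cancel (hu'.symm.trans hu)
  rw [Subtype.ext hgf]

/-- The parametrization `(f, ξ) ↦ f + G ξ` of the domain of the adjoint. -/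
def adjointDomainEquiv (hG : IsGreenMap S τ z G) (hA : IsTraceRestriction A S τ)
    (hS : S.IsFormalAdjoint S) (hz : z ∈ resolventSet S) (hz' : conj z ∈ resolventSet S) :
    (S.domain × 𝓗) ≃ₗ[ℂ] A.adjoint.domain :=
  LinearEquiv.ofBijective
    ((S.domain.subtype.coprod G).codRestrict A.adjoint.domain fun p =>
      hG.add_mem_adjoint_domain hA hS p.1 p.2)
    ((Function.bijective_iff_existsUnique _).2 fun u => by
      obtain ⟨p, hp, huniq⟩ := hG.existsUnique_eq_add hA hS hz hz' u
      exact ⟨p, Subtype.ext hp.symm, fun q hq => huniq q (congrArg Subtype.val hq).symm⟩)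

theorem adjointDomainEquiv_symm_apply (hG : IsGreenMap S τ z G) (hA : IsTraceRestriction A S τ)
    (hS : S.IsFormalAdjoint S) (hz : z ∈ resolventSet S) (hz' : conj z ∈ resolventSet S)
    {u : A.adjoint.domain} {f : S.domain} {ξ : 𝓗} (hu : (u : 𝔥) = f + G ξ) :
    (hG.adjointDomainEquiv hA hS hz hz').symm u = (f, ξ) :=
  (LinearEquiv.symm_apply_eq _).2 (Subtype.ext hu)

variable {c : ℝ}

theorem green_identity (hG : IsGreenMap S τ c G) (hA : IsTraceRestriction A S τ)
    (hS : S.IsFormalAdjoint S) (hc : (c : ℂ) ∈ resolventSet S) (hW : W.IsSymmetric)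
    {u v : A.adjoint.domain} {f g : S.domain} {ξ η : 𝓗}
    (hu : (u : 𝔥) = f + G ξ) (hv : (v : 𝔥) = g + G η) :
    inner ℂ (A.adjoint u) (v : 𝔥) - inner ℂ (u : 𝔥) (A.adjoint v) =
      inner ℂ (τ f + W ξ) η - inner ℂ ξ (τ g + W η) := by
  have hc' : conj (c : ℂ) ∈ resolventSet S := by rwa [Complex.conj_ofReal]
  have hξ := hG.inner_apply ξ g
  have hη := congrArg conj (hG.inner_apply η f)
  rw [inner_conj_symm, inner_conj_symm] at hη
  rw [hG.adjoint_apply hA hS hc hc' hu, hG.adjoint_apply hA hS hc hc' hv, hu, hv]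
  simp only [inner_add_left, inner_add_right, inner_sub_left, inner_sub_right, inner_smul_left,
    inner_smul_right, Complex.conj_ofReal] at hξ hη ⊢
  linear_combination hS f g + hη - hξ - hW ξ η

theorem exists_isGreenTriplet (hG : IsGreenMap S τ c G) (hA : IsTraceRestriction A S τ)
    (hS : S.IsFormalAdjoint S) (hc : (c : ℂ) ∈ resolventSet S) (hW : W.IsSymmetric) :
    ∃ P : BoundaryTriplet A 𝓗, P.IsGreenTriplet τ G W := by
  have hc' : conj (c : ℂ) ∈ resolventSet S := by rwa [Complex.conj_ofReal]
  let e := hG.adjointDomainEquiv hA hS hc hc'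
  have he (u : A.adjoint.domain) : (u : 𝔥) = (e.symm u).1 + G (e.symm u).2 :=
    congrArg Subtype.val (e.apply_symm_apply u).symm
  refine ⟨{
    dense_domain := hG.dense_domain hA hS hc hc'
    isClosed := hG.isClosed hA hc'
    symmetric := hA.isFormalAdjoint hS
    Γ₀ := LinearMap.snd ℂ S.domain 𝓗 ∘ₗ e.symm.toLinearMap
    Γ₁ := τ.coprod W ∘ₗ e.symm.toLinearMap
    green := fun u v => hG.green_identity hA hS hc hW (he u) (he v)
    surjective := ?_ }, fun u f ξ hu => ?_⟩
  · rintro ⟨ξ, η⟩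
    obtain ⟨f, hf⟩ := hG.surjective_trace hc' (η - W ξ)
    exact ⟨e (f, ξ), by simp [hf]⟩
  · have hcoord : e.symm u = (f, ξ) := hG.adjointDomainEquiv_symm_apply hA hS hc hc' hu
    simp [hcoord]

end IsGreenMap

end TripletOfGreenMap

section RadialFourier

open FourierTransform Real

/-- The splitting of `ℝⁿ⁺¹` into the first coordinate axis and the hyperplane orthogonal to it. -/
def axisEquiv (n : ℕ) : ℝ × EuclideanSpace ℝ (Fin n) ≃ᵐ EuclideanSpace ℝ (Fin (n + 1)) :=
  ((MeasurableEquiv.refl ℝ).prodCongr (MeasurableEquiv.toLp 2 (Fin n → ℝ)).symm).trans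
    ((MeasurableEquiv.piFinSuccAbove (fun _ : Fin (n + 1) => ℝ) 0).symm.trans
      (MeasurableEquiv.toLp 2 (Fin (n + 1) → ℝ)))

theorem measurePreserving_axisEquiv (n : ℕ) : MeasurePreserving (axisEquiv n) :=
  ((PiLp.volume_preserving_toLp (Fin (n + 1))).comp
    (volume_preserving_piFinSuccAbove (fun _ : Fin (n + 1) => ℝ) 0).symm).comp
    ((MeasurePreserving.id volume).prod (PiLp.volume_preserving_ofLp (Fin n)))

theorem axisEquiv_apply_zero {n : ℕ} (s : ℝ) (y : EuclideanSpace ℝ (Fin n)) :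
    axisEquiv n (s, y) 0 = s := rfl

theorem axisEquiv_apply_succ {n : ℕ} (s : ℝ) (y : EuclideanSpace ℝ (Fin n)) (i : Fin n) :
    axisEquiv n (s, y) i.succ = y i := rfl

theorem norm_axisEquiv {n : ℕ} (s : ℝ) (y : EuclideanSpace ℝ (Fin n)) :
    ‖axisEquiv n (s, y)‖ = √(s ^ 2 + ‖y‖ ^ 2) := by
  rw [EuclideanSpace.norm_eq, Fin.sum_univ_succ, EuclideanSpace.norm_sq_eq]
  simp only [axisEquiv_apply_succ, axisEquiv_apply_zero, norm_eq_abs, sq_abs]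

theorem exists_linearIsometryEquiv_apply_eq {V : Type*} [NormedAddCommGroup V]
    [InnerProductSpace ℝ V] {v w : V} (h : ‖v‖ = ‖w‖) : ∃ A : V ≃ₗᵢ[ℝ] V, A v = w :=
  ⟨(ℝ ∙ (v - w))ᗮ.reflection, Submodule.reflection_sub h⟩

variable {F : Type*} [NormedAddCommGroup F]

theorem integral_Ioi_comp_sqrt [NormedSpace ℝ F] (s : ℝ) (g : ℝ → F) :
    ∫ ρ in Set.Ioi 0, (ρ / √(s ^ 2 + ρ ^ 2)) • g √(s ^ 2 + ρ ^ 2) = ∫ r in Set.Ioi |s|, g r := by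
  have hderiv : ∀ ρ ∈ Set.Ioi (0 : ℝ),
      HasDerivWithinAt (fun ρ => √(s ^ 2 + ρ ^ 2)) (ρ / √(s ^ 2 + ρ ^ 2)) (Set.Ioi 0) ρ := by
    intro ρ (hρ : 0 < ρ)
    have h := (((hasDerivAt_pow 2 ρ).const_add (s ^ 2)).sqrt (by positivity)).hasDerivWithinAt
      (s := Set.Ioi 0)
    simpa [mul_div_mul_left] using h
  have hinj : Set.InjOn (fun ρ => √(s ^ 2 + ρ ^ 2)) (Set.Ioi 0) := by
    intro ρ (hρ : 0 < ρ) σ (hσ : 0 < σ) h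
    have h' := (Real.sqrt_inj (by positivity) (by positivity)).1 h
    exact (pow_left_inj₀ hρ.le hσ.le two_ne_zero).1 (add_left_cancel h')
  have himage : (fun ρ => √(s ^ 2 + ρ ^ 2)) '' Set.Ioi 0 = Set.Ioi |s| := by
    ext r
    constructor
    · rintro ⟨ρ, hρ : 0 < ρ, rfl⟩
      exact Real.lt_sqrt_of_sq_lt (by rw [sq_abs]; nlinarith)
    · intro (hr : |s| < r)
      have hsq : 0 < r ^ 2 - s ^ 2 := sub_pos.2 (sq_lt_sq.2 (hr.trans_le (le_abs_self r)))
      refine ⟨√(r ^ 2 - s ^ 2), Real.sqrt_pos.2 hsq, ?_⟩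
      simp only [Real.sq_sqrt hsq.le, add_sub_cancel]
      exact Real.sqrt_sq ((abs_nonneg s).trans hr.le)
  rw [← himage, integral_image_eq_integral_abs_deriv_smul measurableSet_Ioi hderiv hinj]
  refine setIntegral_congr_fun measurableSet_Ioi fun ρ (hρ : 0 < ρ) => ?_
  rw [abs_of_nonneg (by positivity)]

theorem integral_plane_comp_sqrt [NormedSpace ℝ F] (s : ℝ) (f : ℝ → F) :
    ∫ y : EuclideanSpace ℝ (Fin 2), f √(s ^ 2 + ‖y‖ ^ 2) =
      (2 * π) • ∫ r in Set.Ioi |s|, r • f r := by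
  have hdisc : (volume : Measure (EuclideanSpace ℝ (Fin 2))).real (Metric.ball 0 1) = π := by
    rw [Measure.real, EuclideanSpace.volume_ball]
    simp [one_add_one_eq_two, pi_pos.le]
  rw [integral_fun_norm_addHaar volume fun ρ => f √(s ^ 2 + ρ ^ 2), ← integral_Ioi_comp_sqrt,
    finrank_euclideanSpace_fin, hdisc, ← Nat.cast_smul_eq_nsmul ℝ, smul_smul]
  congr 1
  refine setIntegral_congr_fun measurableSet_Ioi fun ρ (hρ : 0 < ρ) => ?_
  have hpos : 0 < √(s ^ 2 + ρ ^ 2) := by positivity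
  simp only [Nat.add_one_sub_one, pow_one, smul_smul, div_mul_cancel₀ ρ hpos.ne']

variable [NormedSpace ℂ F]

theorem fourier_comp_norm {n : ℕ} {f : ℝ → F}
    (hf : Integrable fun y : EuclideanSpace ℝ (Fin (n + 1)) => f ‖y‖)
    (ξ : EuclideanSpace ℝ (Fin (n + 1))) :
    𝓕 (fun y : EuclideanSpace ℝ (Fin (n + 1)) => f ‖y‖) ξ =
      𝓕 (fun s : ℝ => ∫ y : EuclideanSpace ℝ (Fin n), f √(s ^ 2 + ‖y‖ ^ 2)) ‖ξ‖ := by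
  set e : EuclideanSpace ℝ (Fin (n + 1)) := EuclideanSpace.single 0 ‖ξ‖
  obtain ⟨A, hA⟩ := exists_linearIsometryEquiv_apply_eq (v := ξ) (w := e) (by simp [e])
  have hrot : (fun y => f ‖y‖) ∘ A = fun y : EuclideanSpace ℝ (Fin (n + 1)) => f ‖y‖ := by
    ext y
    rw [Function.comp_apply, A.norm_map]
  have hinner (s : ℝ) (y : EuclideanSpace ℝ (Fin n)) :
      inner ℝ (axisEquiv n (s, y)) e = s * ‖ξ‖ := by
    rw [EuclideanSpace.inner_single_right, axisEquiv_apply_zero]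
    simp [mul_comm]
  have hint : Integrable fun p : ℝ × EuclideanSpace ℝ (Fin n) =>
      𝐞 (-inner ℝ (axisEquiv n p) e) • f ‖axisEquiv n p‖ :=
    ((measurePreserving_axisEquiv n).integrable_comp_emb (axisEquiv n).measurableEmbedding).2
      ((Real.fourierIntegral_convergent_iff e).2 hf)
  rw [← hrot, Real.fourier_comp_linearIsometry, hA, Real.fourier_eq, Real.fourier_real_eq,
    ← (measurePreserving_axisEquiv n).integral_comp (axisEquiv n).measurableEmbedding,
    Measure.volume_eq_prod, integral_prod _ hint]
  simp only [hinner, norm_axisEquiv, Circle.smul_def, integral_smul]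

end RadialFourier

section Yukawa

open FourierTransform Real

/-- The Yukawa potential `e^{-κ|y|} / (4π|y|)`, which is the Green function of `-Δ + κ²` when
`Re κ > 0`. Division by zero makes its value at `y = 0` equal to `0`. -/
def yukawa (κ : ℂ) (y : Space) : ℂ := Complex.exp (-κ * ‖y‖) / (4 * π * ‖y‖)

theorem yukawa_zero (κ : ℂ) : yukawa κ 0 = 0 := by simp [yukawa]

theorem yukawa_neg (κ : ℂ) (y : Space) : yukawa κ (-y) = yukawa κ y := by
  rw [yukawa, norm_neg, yukawa]

theorem norm_yukawa (κ : ℂ) (y : Space) :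
    ‖yukawa κ y‖ = rexp (-κ.re * ‖y‖) / (4 * π * ‖y‖) := by
  simp [yukawa, Complex.norm_exp, abs_of_pos pi_pos]

theorem measurable_yukawa (κ : ℂ) : Measurable (yukawa κ) := by
  unfold yukawa
  fun_prop

theorem continuousAt_yukawa (κ : ℂ) {y : Space} (hy : y ≠ 0) : ContinuousAt (yukawa κ) y := by
  have h : (4 * π * ‖y‖ : ℂ) ≠ 0 := by simpa [pi_ne_zero] using hy
  unfold yukawa
  fun_prop (disch := exact h)

variable {κ : ℂ}

theorem integrable_yukawa (hκ : 0 < κ.re) : Integrable (yukawa κ) := by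
  rw [← integrable_norm_iff (measurable_yukawa κ).aestronglyMeasurable]
  simp_rw [norm_yukawa]
  rw [integrable_fun_norm_addHaar volume (f := fun r : ℝ => rexp (-κ.re * r) / (4 * π * r))]
  have h := (integrableOn_rpow_mul_exp_neg_mul_rpow (p := 1) (s := 1) (b := κ.re)
    (by norm_num) one_pos hκ).const_mul (4 * π)⁻¹
  refine IntegrableOn.congr_fun h (fun r (hr : 0 < r) => ?_) measurableSet_Ioi
  simp only [Real.rpow_one, finrank_euclideanSpace, Fintype.card_fin, smul_eq_mul]
  field_simp

theorem memLp_yukawa (hκ : 0 < κ.re) : MemLp (yukawa κ) 2 := by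
  rw [memLp_two_iff_integrable_sq_norm (measurable_yukawa κ).aestronglyMeasurable]
  simp_rw [norm_yukawa]
  rw [integrable_fun_norm_addHaar volume
    (f := fun r : ℝ => (rexp (-κ.re * r) / (4 * π * r)) ^ 2)]
  have h := (exp_neg_integrableOn_Ioi 0 (b := 2 * κ.re) (by positivity)).const_mul
    ((4 * π)⁻¹ ^ 2)
  refine IntegrableOn.congr_fun h (fun r (hr : 0 < r) => ?_) measurableSet_Ioi
  have hexp : rexp (-(2 * κ.re) * r) = rexp (-κ.re * r) ^ 2 := by
    rw [← Real.exp_nat_mul]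
    push_cast
    ring_nf
  simp only [finrank_euclideanSpace, Fintype.card_fin, smul_eq_mul, hexp]
  field_simp

theorem integral_exp_mul_sub_mul_abs {c : ℂ} (hc : |c.re| < κ.re) :
    ∫ s : ℝ, Complex.exp (c * s - κ * |s|) = (κ - c)⁻¹ + (κ + c)⁻¹ := by
  obtain ⟨hneg, hpos⟩ := abs_lt.1 hc
  have hIoi : Set.EqOn (fun s : ℝ => Complex.exp ((c - κ) * s))
      (fun s : ℝ => Complex.exp (c * s - κ * |s|)) (Set.Ioi 0) := by
    intro s (hs : 0 < s)
    simp only [abs_of_pos hs, sub_mul]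
  have hIic : Set.EqOn (fun s : ℝ => Complex.exp ((c + κ) * s))
      (fun s : ℝ => Complex.exp (c * s - κ * |s|)) (Set.Iic 0) := by
    intro s (hs : s ≤ 0)
    simp only [abs_of_nonpos hs, add_mul, Complex.ofReal_neg, mul_neg, sub_neg_eq_add]
  have hre : (c - κ).re < 0 := by simpa using hpos
  have hre' : 0 < (c + κ).re := by rw [Complex.add_re]; linarith
  rw [← intervalIntegral.integral_Iic_add_Ioi
      ((integrableOn_exp_mul_complex_Iic hre' 0).congr_fun hIic measurableSet_Iic)
      ((integrableOn_exp_mul_complex_Ioi hre 0).congr_fun hIoi measurableSet_Ioi),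
    ← setIntegral_congr_fun measurableSet_Iic hIic, ← setIntegral_congr_fun measurableSet_Ioi hIoi,
    integral_exp_mul_complex_Ioi hre, integral_exp_mul_complex_Iic hre']
  rw [Complex.ofReal_zero, mul_zero, mul_zero, Complex.exp_zero, neg_div, ← div_neg, neg_sub,
    one_div, one_div, add_comm, add_comm c]

theorem fourier_exp_neg_mul_abs (hκ : 0 < κ.re) (t : ℝ) :
    𝓕 (fun s : ℝ => Complex.exp (-κ * |s|) / (2 * κ)) t = ((2 * π * t) ^ 2 + κ ^ 2 : ℂ)⁻¹ := by
  set c : ℂ := -(2 * π * t) * Complex.I with hc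
  have hre : |c.re| < κ.re := by simpa [hc] using hκ
  have hne {w : ℂ} (hw : |w.re| < κ.re) : κ - w ≠ 0 := by
    intro h
    rw [sub_eq_zero.1 h] at hw
    exact (le_abs_self _).not_gt hw
  have hsub := hne hre
  have hadd := hne (w := -c) (by simpa using hre)
  have hκ₀ := hne (w := 0) (by simpa using hκ)
  rw [sub_neg_eq_add] at hadd
  rw [sub_zero] at hκ₀
  have hfactor : (2 * π * t : ℂ) ^ 2 + κ ^ 2 = (κ - c) * (κ + c) := by
    rw [hc]
    linear_combination (2 * π * t : ℂ) ^ 2 * Complex.I_sq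
  calc 𝓕 (fun s : ℝ => Complex.exp (-κ * |s|) / (2 * κ)) t
      = ∫ s : ℝ, Complex.exp (c * s - κ * |s|) / (2 * κ) := by
        rw [Real.fourier_real_eq_integral_exp_smul]
        refine integral_congr_ae (ae_of_all _ fun s => ?_)
        simp only [smul_eq_mul, mul_div_assoc', ← Complex.exp_add, hc]
        push_cast
        ring_nf
    _ = ((κ - c)⁻¹ + (κ + c)⁻¹) / (2 * κ) := by
        rw [integral_div, integral_exp_mul_sub_mul_abs hre]
    _ = _ := by
        rw [hfactor]
        field_simp
        ring

theorem integral_plane_yukawa (hκ : 0 < κ.re) (s : ℝ) :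
    ∫ y : EuclideanSpace ℝ (Fin 2),
        Complex.exp (-κ * √(s ^ 2 + ‖y‖ ^ 2)) / (4 * π * √(s ^ 2 + ‖y‖ ^ 2)) =
      Complex.exp (-κ * |s|) / (2 * κ) := by
  rw [integral_plane_comp_sqrt s fun r : ℝ => Complex.exp (-κ * r) / (4 * π * r)]
  have hcongr : Set.EqOn (fun r : ℝ => r • (Complex.exp (-κ * r) / (4 * π * r)))
      (fun r : ℝ => Complex.exp (-κ * r) / (4 * π)) (Set.Ioi |s|) := by
    intro r (hr : |s| < r)
    have hr₀ : (r : ℂ) ≠ 0 := by exact_mod_cast ((abs_nonneg s).trans_lt hr).ne'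
    simp only [Complex.real_smul]
    field_simp
  have hκ₀ : κ ≠ 0 := by
    rintro rfl
    simp at hκ
  rw [setIntegral_congr_fun measurableSet_Ioi hcongr, integral_div,
    integral_exp_mul_complex_Ioi (by simpa using hκ), Complex.real_smul]
  push_cast
  field_simp
  norm_num

theorem fourier_yukawa (hκ : 0 < κ.re) (ξ : Space) :
    𝓕 (yukawa κ) ξ = ((2 * π * ‖ξ‖) ^ 2 + κ ^ 2 : ℂ)⁻¹ := by
  have h := fourier_comp_norm (f := fun r : ℝ => Complex.exp (-κ * r) / (4 * π * r))
    (integrable_yukawa hκ) ξ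
  simp only [integral_plane_yukawa hκ, fourier_exp_neg_mul_abs hκ] at h
  exact h

end Yukawa

section LaplacianSymbol

open Real

variable {V : Type*} [NormedAddCommGroup V]

/-- The Fourier symbol of `-Δ`. -/
def laplacianSymbol (ξ : V) : ℝ := (2 * π * ‖ξ‖) ^ 2

theorem ofReal_laplacianSymbol_eq :
    (fun ξ : V => (laplacianSymbol ξ : ℂ)) =
      ((2 * π) ^ 2 : ℂ) • fun ξ => Complex.ofReal (‖ξ‖ ^ 2) := by
  ext ξ
  simp [laplacianSymbol, mul_pow]

theorem sq_re_le_norm_laplacianSymbol_add {κ : ℂ} (hκ : 0 < κ.re) (ξ : V) :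
    κ.re ^ 2 ≤ ‖(laplacianSymbol ξ : ℂ) + κ ^ 2‖ := by
  set t : ℝ := 2 * π * ‖ξ‖
  have hfactor : (laplacianSymbol ξ : ℂ) + κ ^ 2 = (κ + t * Complex.I) * (κ - t * Complex.I) := by
    rw [show laplacianSymbol ξ = t ^ 2 from rfl]
    push_cast
    linear_combination (t : ℂ) ^ 2 * Complex.I_sq
  have hadd : κ.re ≤ ‖κ + t * Complex.I‖ := by
    simpa using Complex.re_le_norm (κ + t * Complex.I)
  have hsub : κ.re ≤ ‖κ - t * Complex.I‖ := by
    simpa using Complex.re_le_norm (κ - t * Complex.I)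
  rw [hfactor, norm_mul, sq]
  exact mul_le_mul hadd hsub hκ.le (norm_nonneg _)

theorem laplacianSymbol_add_ne_zero {κ : ℂ} (hκ : 0 < κ.re) (ξ : V) :
    (laplacianSymbol ξ : ℂ) + κ ^ 2 ≠ 0 :=
  norm_pos_iff.1 ((pow_pos hκ 2).trans_le (sq_re_le_norm_laplacianSymbol_add hκ ξ))

theorem hasTemperateGrowth_laplacianSymbol [InnerProductSpace ℝ V] :
    (fun ξ : V => (laplacianSymbol ξ : ℂ)).HasTemperateGrowth := by
  have h : (fun ξ : V => (laplacianSymbol ξ : ℂ)) =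
      fun ξ => ((2 * π) ^ 2 : ℂ) * Complex.ofReal (‖ξ‖ ^ 2) := ofReal_laplacianSymbol_eq
  rw [h]
  fun_prop

end LaplacianSymbol

section FourierL2

open FourierTransform Real
open scoped Laplacian

variable {V F : Type*} [NormedAddCommGroup V] [InnerProductSpace ℝ V] [FiniteDimensional ℝ V]
  [MeasurableSpace V] [BorelSpace V] [NormedAddCommGroup F]

theorem locallyIntegrable_coeFn {p : ℝ≥0∞} [Fact (1 ≤ p)] (f : Lp F p (volume : Measure V)) :
    LocallyIntegrable f :=
  (Lp.memLp f).locallyIntegrable Fact.out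

variable [InnerProductSpace ℂ F]

theorem continuous_fourier_of_integrable {f : V → F} (hf : Integrable f) : Continuous (𝓕 f) :=
  VectorFourier.fourierIntegral_continuous Real.continuous_fourierChar continuous_inner hf

theorem continuous_fourierInv_of_integrable {f : V → F} (hf : Integrable f) :
    Continuous (𝓕⁻ f) := by
  rw [Real.fourierInv_eq_fourier_comp_neg f]
  exact continuous_fourier_of_integrable hf.comp_neg

variable [CompleteSpace F]

theorem ae_eq_of_integral_schwartz_smul_eq {f g : V → F} (hf : LocallyIntegrable f)
    (hg : LocallyIntegrable g) (h : ∀ φ : 𝓢(V, ℂ), ∫ x, φ x • f x = ∫ x, φ x • g x) :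
    f =ᵐ[volume] g := by
  refine ae_eq_of_integral_contDiff_smul_eq hf hg fun φ hφ hφc => ?_
  have hsupp : HasCompactSupport (Complex.ofRealCLM ∘ φ) := hφc.comp_left rfl
  have hsmooth : ContDiff ℝ (⊤ : ℕ∞) (Complex.ofRealCLM ∘ φ) := by fun_prop
  simpa using h (hsupp.toSchwartzMap hsmooth)

theorem ae_eq_of_toTemperedDistribution_eq {p q : ℝ≥0∞} [Fact (1 ≤ p)] [Fact (1 ≤ q)]
    {f : Lp F p (volume : Measure V)} {g : Lp F q (volume : Measure V)}
    (h : (f : 𝓢'(V, F)) = g) : f =ᵐ[volume] g := by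
  refine ae_eq_of_integral_schwartz_smul_eq (locallyIntegrable_coeFn f)
    (locallyIntegrable_coeFn g) fun φ => ?_
  rw [← Lp.toTemperedDistribution_apply, ← Lp.toTemperedDistribution_apply, h]

theorem toTemperedDistribution_eq_smulLeftCLM_iff {g : V → ℂ} (hg : g.HasTemperateGrowth)
    (f h : Lp F 2 (volume : Measure V)) :
    (h : 𝓢'(V, F)) = TemperedDistribution.smulLeftCLM F g f ↔
      h =ᵐ[volume] fun x => g x • f x := by
  have hval (φ : 𝓢(V, ℂ)) : TemperedDistribution.smulLeftCLM F g (f : 𝓢'(V, F)) φ =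
      ∫ x, φ x • (g x • f x) := by
    rw [TemperedDistribution.smulLeftCLM_apply_apply, Lp.toTemperedDistribution_apply]
    refine integral_congr_ae (ae_of_all _ fun x => ?_)
    simp [SchwartzMap.smulLeftCLM_apply_apply hg, smul_smul, mul_comm]
  constructor <;> intro H
  · have hloc : LocallyIntegrable (fun x => g x • f x) := by
      exact (locallyIntegrable_coeFn f).continuous_smul hg.1.continuous
    refine ae_eq_of_integral_schwartz_smul_eq (locallyIntegrable_coeFn h) hloc fun φ => ?_
    rw [← hval, ← H, Lp.toTemperedDistribution_apply]
  · ext φ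
    rw [hval, Lp.toTemperedDistribution_apply]
    refine integral_congr_ae ?_
    filter_upwards [H] with x hx
    rw [hx]

theorem integral_fourier_schwartz_smul (φ : 𝓢(V, ℂ)) {f : V → F} (hf : Integrable f) :
    ∫ x, (𝓕 φ : 𝓢(V, ℂ)) x • f x = ∫ x, φ x • 𝓕 f x := by
  have h := VectorFourier.integral_fourierIntegral_smul_eq_flip (L := innerₗ V) (f := φ) (g := f)
    Real.continuous_fourierChar continuous_inner (φ.integrable (μ := volume)) hf
  rw [flip_innerₗ] at h
  exact h

theorem coeFn_fourier_of_integrable {f : Lp F 2 (volume : Measure V)} (hf : Integrable f) :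
    (𝓕 f : Lp F 2 (volume : Measure V)) =ᵐ[volume] 𝓕 (f : V → F) := by
  refine ae_eq_of_integral_schwartz_smul_eq (locallyIntegrable_coeFn _)
    (continuous_fourier_of_integrable hf).locallyIntegrable fun φ => ?_
  rw [← integral_fourier_schwartz_smul φ hf, ← Lp.toTemperedDistribution_apply,
    ← Lp.toTemperedDistribution_apply, ← Lp.fourier_toTemperedDistribution_eq,
    TemperedDistribution.fourier_apply]

theorem integral_fourierInv_schwartz_smul (φ : 𝓢(V, ℂ)) {f : V → F} (hf : Integrable f) :
    ∫ x, (𝓕⁻ φ : 𝓢(V, ℂ)) x • f x = ∫ x, φ x • 𝓕⁻ f x := by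
  have h := integral_fourier_schwartz_smul φ hf.comp_neg
  simp only [Real.fourierInv_eq_fourier_comp_neg f]
  rw [← h, ← integral_neg_eq_self]
  refine integral_congr_ae (ae_of_all _ fun x => ?_)
  simp only [SchwartzMap.fourierInv_coe, SchwartzMap.fourier_coe, Real.fourierInv_eq_fourier_neg,
    neg_neg]

theorem coeFn_fourierInv_of_integrable {f : Lp F 2 (volume : Measure V)} (hf : Integrable f) :
    (𝓕⁻ f : Lp F 2 (volume : Measure V)) =ᵐ[volume] 𝓕⁻ (f : V → F) := by
  refine ae_eq_of_integral_schwartz_smul_eq (locallyIntegrable_coeFn _)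
    (continuous_fourierInv_of_integrable hf).locallyIntegrable fun φ => ?_
  rw [← integral_fourierInv_schwartz_smul φ hf, ← Lp.toTemperedDistribution_apply,
    ← Lp.toTemperedDistribution_apply, ← Lp.fourierInv_toTemperedDistribution_eq,
    TemperedDistribution.fourierInv_apply]

theorem integrable_fourier_of_memSobolev {s : ℝ} (hs : Module.finrank ℝ V < 2 * s)
    {f : Lp F 2 (volume : Measure V)}
    (hf : TemperedDistribution.MemSobolev s 2 (f : 𝓢'(V, F))) :
    Integrable (𝓕 f : Lp F 2 (volume : Measure V)) := by
  obtain ⟨v, hv⟩ := hf.fourier_memL1 hs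
  rw [Lp.fourier_toTemperedDistribution_eq] at hv
  exact (L1.integrable_coeFn v).congr (ae_eq_of_toTemperedDistribution_eq hv).symm

theorem coeFn_fourier_add_smul (f g : Lp F 2 (volume : Measure V)) (c : ℂ) :
    (𝓕 (f + c • g) : Lp F 2 (volume : Measure V)) =ᵐ[volume]
      fun ξ => (𝓕 f : Lp F 2 (volume : Measure V)) ξ +
        c • (𝓕 g : Lp F 2 (volume : Measure V)) ξ := by
  rw [FourierTransform.fourier_add, FourierTransform.fourier_smul]
  filter_upwards [Lp.coeFn_add (𝓕 f : Lp F 2 (volume : Measure V)) (c • 𝓕 g),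
    Lp.coeFn_smul c (𝓕 g : Lp F 2 (volume : Measure V))] with ξ hadd hsmul
  rw [hadd, Pi.add_apply, hsmul, Pi.smul_apply]

theorem eq_of_fourier_ae_eq {f g : Lp F 2 (volume : Measure V)}
    (h : (𝓕 f : Lp F 2 (volume : Measure V)) =ᵐ[volume] (𝓕 g : Lp F 2 (volume : Measure V))) :
    f = g :=
  (Lp.fourierTransformₗᵢ V F).injective (Lp.ext h)

theorem exists_continuousLinearMap_fourier_ae_eq_smul {g : V → ℂ}
    (hg : MemLp g ∞ (volume : Measure V)) :
    ∃ T : Lp F 2 (volume : Measure V) →L[ℂ] Lp F 2 (volume : Measure V), ∀ w,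
      (𝓕 (T w) : Lp F 2 (volume : Measure V)) =ᵐ[volume]
        fun ξ => g ξ • (𝓕 w : Lp F 2 (volume : Measure V)) ξ := by
  let e := (Lp.fourierTransformₗᵢ V F).toContinuousLinearEquiv
  let B : ℂ →L[ℂ] F →L[ℂ] F := ContinuousLinearMap.lsmul ℂ ℂ
  refine ⟨e.symm ∘L B.holderL volume ∞ 2 2 hg.toLp ∘L e.toContinuousLinearMap, fun w => ?_⟩
  have hT : (𝓕 (e.symm (B.holder 2 hg.toLp (𝓕 w))) : Lp F 2 (volume : Measure V)) =
      B.holder 2 hg.toLp (𝓕 w) := e.apply_symm_apply _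
  refine (Lp.ext_iff.1 hT).trans ?_
  filter_upwards [B.coeFn_holder (r := 2) hg.toLp (𝓕 w : Lp F 2 (volume : Measure V)),
    hg.coeFn_toLp] with ξ hholder hcoe
  rw [hholder, hcoe]
  rfl

/-- `T` is multiplication by the real function `p` on the Fourier side, with maximal domain. -/
def IsFourierMultiplier (T : Lp F 2 (volume : Measure V) →ₗ.[ℂ] Lp F 2 (volume : Measure V))
    (p : V → ℝ) : Prop :=
  ∀ f h : Lp F 2 (volume : Measure V), (f, h) ∈ T.graph ↔
    (𝓕 h : Lp F 2 (volume : Measure V)) =ᵐ[volume]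
      fun ξ => (p ξ : ℂ) • (𝓕 f : Lp F 2 (volume : Measure V)) ξ

namespace IsFourierMultiplier

variable {T : Lp F 2 (volume : Measure V) →ₗ.[ℂ] Lp F 2 (volume : Measure V)} {p : V → ℝ}

theorem fourier_apply (hT : IsFourierMultiplier T p) (f : T.domain) :
    (𝓕 (T f) : Lp F 2 (volume : Measure V)) =ᵐ[volume]
      fun ξ => (p ξ : ℂ) • (𝓕 (f : Lp F 2 (volume : Measure V)) : Lp F 2 volume) ξ :=
  (hT _ _).1 (T.mem_graph f)

theorem fourier_apply_sub_smul (hT : IsFourierMultiplier T p) (f : T.domain) (z : ℂ) :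
    (𝓕 (T f - z • (f : Lp F 2 (volume : Measure V))) : Lp F 2 (volume : Measure V)) =ᵐ[volume]
      fun ξ => ((p ξ : ℂ) - z) • (𝓕 (f : Lp F 2 (volume : Measure V)) : Lp F 2 volume) ξ := by
  rw [sub_eq_add_neg, ← neg_smul]
  filter_upwards [coeFn_fourier_add_smul (T f) f (-z), hT.fourier_apply f] with ξ hadd hf
  rw [hadd, hf, ← add_smul, ← sub_eq_add_neg]

theorem isFormalAdjoint (hT : IsFourierMultiplier T p) : T.IsFormalAdjoint T := by
  intro f g
  rw [← Lp.inner_fourier_eq, ← Lp.inner_fourier_eq (f : Lp F 2 (volume : Measure V)),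
    L2.inner_def, L2.inner_def]
  refine integral_congr_ae ?_
  filter_upwards [hT.fourier_apply f, hT.fourier_apply g] with ξ hf hg
  rw [hf, hg, inner_smul_left, inner_smul_right, Complex.conj_ofReal]

theorem mem_resolventSet (hT : IsFourierMultiplier T p) {z : ℂ} (hz : ∀ ξ, (p ξ : ℂ) ≠ z)
    (hbdd : MemLp (fun ξ => ((p ξ : ℂ) - z)⁻¹) ∞ (volume : Measure V)) : z ∈ resolventSet T := by
  obtain ⟨R, hR⟩ := exists_continuousLinearMap_fourier_ae_eq_smul (F := F) hbdd
  refine ⟨R, fun w => ?_, fun f => ?_⟩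
  · have hgraph : (R w, w + z • R w) ∈ T.graph := by
      refine (hT _ _).2 ?_
      filter_upwards [coeFn_fourier_add_smul w (R w) z, hR w] with ξ hadd hRw
      have := sub_ne_zero.2 (hz ξ)
      rw [hadd, hRw]
      match_scalars
      field_simp
      ring
    obtain ⟨f, hf, hTf⟩ := T.mem_graph_iff.1 hgraph
    dsimp only at hf hTf
    refine ⟨hf ▸ f.2, ?_⟩
    rw [show (⟨R w, hf ▸ f.2⟩ : T.domain) = f from Subtype.ext hf.symm, hTf, add_sub_cancel_right]
  · refine eq_of_fourier_ae_eq ?_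
    filter_upwards [hR (T f - z • (f : Lp F 2 (volume : Measure V))),
      hT.fourier_apply_sub_smul f z] with ξ hRf hf
    rw [hRf, hf, smul_smul, inv_mul_cancel₀ (sub_ne_zero.2 (hz ξ)), one_smul]

end IsFourierMultiplier

theorem neg_laplacian_toTemperedDistribution (f : Lp F 2 (volume : Measure V)) :
    -Δ (f : 𝓢'(V, F)) = 𝓕⁻ (TemperedDistribution.smulLeftCLM F
      (fun ξ => (laplacianSymbol ξ : ℂ)) ((𝓕 f : Lp F 2 (volume : Measure V)) : 𝓢'(V, F))) := by
  rw [TemperedDistribution.laplacian_eq_fourierMultiplierCLM,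
    TemperedDistribution.fourierMultiplierCLM_apply, Lp.fourier_toTemperedDistribution_eq,
    ofReal_laplacianSymbol_eq, TemperedDistribution.smulLeftCLM_smul (by fun_prop), neg_smul,
    neg_neg, ← Complex.coe_smul]
  push_cast
  exact (FourierTransform.fourierInv_smul _ _).symm

theorem eq_neg_laplacian_iff (f h : Lp F 2 (volume : Measure V)) :
    (h : 𝓢'(V, F)) = -Δ (f : 𝓢'(V, F)) ↔
      (𝓕 h : Lp F 2 (volume : Measure V)) =ᵐ[volume]
        fun ξ => (laplacianSymbol ξ : ℂ) • (𝓕 f : Lp F 2 (volume : Measure V)) ξ := by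
  rw [← toTemperedDistribution_eq_smulLeftCLM_iff hasTemperateGrowth_laplacianSymbol,
    neg_laplacian_toTemperedDistribution, ← Lp.fourier_toTemperedDistribution_eq h]
  exact ⟨fun H => by rw [H, FourierTransform.fourier_fourierInv_eq],
    fun H => by rw [← H, FourierTransform.fourierInv_fourier_eq]⟩

theorem memSobolev_two_of_fourier {f h : Lp F 2 (volume : Measure V)}
    (H : (𝓕 h : Lp F 2 (volume : Measure V)) =ᵐ[volume]
      fun ξ => (laplacianSymbol ξ : ℂ) • (𝓕 f : Lp F 2 (volume : Measure V)) ξ) :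
    TemperedDistribution.MemSobolev 2 2 (f : 𝓢'(V, F)) := by
  refine TemperedDistribution.memSobolev_iff_exists_smulLeftCLM_fourier.2
    ⟨𝓕 (f + ((2 * π) ^ 2 : ℂ)⁻¹ • h), ?_⟩
  rw [Lp.fourier_toTemperedDistribution_eq, eq_comm, toTemperedDistribution_eq_smulLeftCLM_iff
    (by fun_prop)]
  have hpi : (π : ℂ) ≠ 0 := by exact_mod_cast pi_ne_zero
  filter_upwards [H, coeFn_fourier_add_smul f h ((2 * π) ^ 2 : ℂ)⁻¹] with ξ hh hadd
  rw [hadd, hh, div_self (two_ne_zero (α := ℝ)), Real.rpow_one, laplacianSymbol]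
  match_scalars
  field_simp

theorem memLp_top_inv_laplacianSymbol_add {κ : ℂ} (hκ : 0 < κ.re) :
    MemLp (fun ξ => ((laplacianSymbol ξ : ℂ) + κ ^ 2)⁻¹) ∞ (volume : Measure V) := by
  have hcont : Continuous fun ξ : V => (laplacianSymbol ξ : ℂ) + κ ^ 2 :=
    hasTemperateGrowth_laplacianSymbol.1.continuous.add continuous_const
  refine memLp_top_of_bound
    (hcont.inv₀ (laplacianSymbol_add_ne_zero hκ)).aestronglyMeasurable (κ.re ^ 2)⁻¹
    (ae_of_all _ fun ξ => ?_)
  rw [norm_inv]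
  exact inv_anti₀ (pow_pos hκ 2) (sq_re_le_norm_laplacianSymbol_add hκ ξ)

theorem IsFourierMultiplier.neg_sq_mem_resolventSet
    {T : Lp F 2 (volume : Measure V) →ₗ.[ℂ] Lp F 2 (volume : Measure V)}
    (hT : IsFourierMultiplier T laplacianSymbol) {κ : ℂ} (hκ : 0 < κ.re) :
    -κ ^ 2 ∈ resolventSet T := by
  refine hT.mem_resolventSet (fun ξ h => laplacianSymbol_add_ne_zero hκ ξ ?_) ?_
  · rw [h, neg_add_cancel]
  · simpa only [sub_neg_eq_add] using memLp_top_inv_laplacianSymbol_add (V := V) hκ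

end FourierL2

section GreenFunctions

open FourierTransform Real
open scoped Laplacian ComplexConjugate

section ContinuousRepresentative

variable {V F : Type*} [NormedAddCommGroup V] [InnerProductSpace ℝ V] [FiniteDimensional ℝ V]
  [MeasurableSpace V] [BorelSpace V] [NormedAddCommGroup F] [InnerProductSpace ℂ F]
  [CompleteSpace F]

/-- The continuous representative of an `L²` function whose Fourier transform is integrable, given
by Fourier inversion. -/
def contRep (f : Lp F 2 (volume : Measure V)) : V → F :=
  𝓕⁻ ((𝓕 f : Lp F 2 (volume : Measure V)) : V → F)

theorem continuous_contRep {f : Lp F 2 (volume : Measure V)}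
    (hf : Integrable (𝓕 f : Lp F 2 (volume : Measure V))) : Continuous (contRep f) :=
  continuous_fourierInv_of_integrable hf

theorem coeFn_ae_eq_contRep {f : Lp F 2 (volume : Measure V)}
    (hf : Integrable (𝓕 f : Lp F 2 (volume : Measure V))) : f =ᵐ[volume] contRep f := by
  have h := coeFn_fourierInv_of_integrable hf
  rwa [FourierTransform.fourierInv_fourier_eq] at h

theorem contRep_eq_of_ae_eq {f : Lp F 2 (volume : Measure V)}
    (hf : Integrable (𝓕 f : Lp F 2 (volume : Measure V))) {u : V → F} (hu : Continuous u)
    (hfu : f =ᵐ[volume] u) : contRep f = u :=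
  ((continuous_contRep hf).ae_eq_iff_eq volume hu).1 ((coeFn_ae_eq_contRep hf).symm.trans hfu)

end ContinuousRepresentative

section FreeOperator

variable {n : ℕ}

/-- The self-adjoint operator `-Δ ⊗ I_n` with domain `W²₂(ℝ³, ℂⁿ)`. -/
abbrev freeOperator (n : ℕ) : L2 n →ₗ.[ℂ] L2 n := ⟨W22 n, negLaplacian n⟩

theorem isFourierMultiplier_freeOperator :
    IsFourierMultiplier (freeOperator n) laplacianSymbol := by
  intro f h
  rw [LinearPMap.mem_graph_iff]
  constructor
  · rintro ⟨f, rfl, rfl⟩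
    exact (eq_neg_laplacian_iff _ _).1 (exists_neg_laplacian f).choose_spec
  · intro H
    let g : W22 n := ⟨f, memSobolev_two_of_fourier H⟩
    have hg : (negLaplacianFun g : 𝓢'(Space, EuclideanSpace ℂ (Fin n))) = h :=
      (exists_neg_laplacian g).choose_spec.trans ((eq_neg_laplacian_iff _ _).2 H).symm
    exact ⟨g, rfl, toTemperedDistribution_inj hg⟩

theorem integrable_fourier_of_mem_W22 {f : L2 n} (hf : f ∈ W22 n) :
    Integrable (𝓕 f : L2 n) :=
  integrable_fourier_of_memSobolev (by rw [finrank_euclideanSpace_fin]; norm_num) hf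

variable {m : ℕ}

/-- The trace map `f ↦ (f(x_j))_j` on `W²₂`, evaluated on continuous representatives. -/
def pointValues (x : Fin m → Space) : W22 n →ₗ[ℂ] BoundarySpace m n where
  toFun f := WithLp.toLp 2 fun j => contRep (f : L2 n) (x j)
  map_add' f g := by
    have hf := integrable_fourier_of_mem_W22 f.2
    have hg := integrable_fourier_of_mem_W22 g.2
    have h := contRep_eq_of_ae_eq (integrable_fourier_of_mem_W22 (f + g).2)
      ((continuous_contRep hf).add (continuous_contRep hg))
      ((Lp.coeFn_add _ _).trans ((coeFn_ae_eq_contRep hf).add (coeFn_ae_eq_contRep hg)))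
    ext1 j
    exact congrFun h (x j)
  map_smul' c f := by
    have hf := integrable_fourier_of_mem_W22 f.2
    have h := contRep_eq_of_ae_eq (integrable_fourier_of_mem_W22 (c • f).2)
      ((continuous_contRep hf).const_smul c)
      ((Lp.coeFn_smul c _).trans ((coeFn_ae_eq_contRep hf).const_smul c))
    ext1 j
    exact congrFun h (x j)

theorem mem_minimalDomain_iff {x : Fin m → Space} {f : L2 n} (hf : f ∈ W22 n) :
    f ∈ minimalDomain n x ↔ ∀ j, contRep f (x j) = 0 := by
  have hint := integrable_fourier_of_mem_W22 hf
  constructor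
  · rintro ⟨-, u, hu, hfu, hux⟩ j
    rw [contRep_eq_of_ae_eq hint hu hfu, hux]
  · intro h
    exact ⟨hf, contRep f, continuous_contRep hint, coeFn_ae_eq_contRep hint, h⟩

theorem isTraceRestriction_minimalOperator (x : Fin m → Space) :
    IsTraceRestriction (minimalOperator n x) (freeOperator n) (pointValues x) where
  le := ⟨minimalDomain_le n x, fun f g hfg => by
    obtain rfl : Submodule.inclusion (minimalDomain_le n x) f = g := Subtype.ext hfg
    rfl⟩
  mem_domain_iff f := by
    rw [PiLp.ext_iff]
    exact mem_minimalDomain_iff f.2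

end FreeOperator

section GreenFunction

variable {F : Type*} [NormedAddCommGroup F] [InnerProductSpace ℂ F] {κ : ℂ}

theorem memLp_yukawa_smul (hκ : 0 < κ.re) (a : Space) (b : F) :
    MemLp (fun y => yukawa κ (y - a) • b) 2 :=
  (ContinuousLinearMap.toSpanSingleton ℂ b).comp_memLp'
    ((memLp_yukawa hκ).comp_measurePreserving (measurePreserving_sub_right volume a))

/-- The Green function of `-Δ + κ²` with pole `a`, as the map
`b ↦ (y ↦ e^{-κ|y - a|} / (4π|y - a|) b)` into `L²`. -/
def greenFun (hκ : 0 < κ.re) (a : Space) : F →ₗ[ℂ] Lp F 2 (volume : Measure Space) where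
  toFun b := (memLp_yukawa_smul hκ a b).toLp
  map_add' b c := by
    rw [← MemLp.toLp_add]
    congr 1
    ext1 y
    exact smul_add _ _ _
  map_smul' c b := by
    rw [RingHom.id_apply, ← MemLp.toLp_const_smul]
    congr 1
    ext1 y
    exact smul_comm _ _ _

theorem coeFn_greenFun (hκ : 0 < κ.re) (a : Space) (b : F) :
    greenFun hκ a b =ᵐ[volume] fun y => yukawa κ (y - a) • b :=
  (memLp_yukawa_smul hκ a b).coeFn_toLp

variable [CompleteSpace F]

theorem fourier_greenFun (hκ : 0 < κ.re) (a : Space) (b : F) :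
    (𝓕 (greenFun hκ a b) : Lp F 2 (volume : Measure Space)) =ᵐ[volume]
      fun ξ => (𝐞 (-inner ℝ a ξ) : ℂ) • ((laplacianSymbol ξ : ℂ) + κ ^ 2)⁻¹ • b := by
  have hint : Integrable (greenFun hκ a b) :=
    (((integrable_yukawa hκ).comp_sub_right a).smul_const b).congr (coeFn_greenFun hκ a b).symm
  refine (coeFn_fourier_of_integrable hint).trans (ae_of_all _ fun ξ => ?_)
  dsimp only
  rw [Real.fourier_congr_ae (coeFn_greenFun hκ a b), Real.fourier_eq,
    ← integral_add_right_eq_self _ a]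
  have hyukawa : (laplacianSymbol ξ : ℂ) + κ ^ 2 = (2 * π * ‖ξ‖) ^ 2 + κ ^ 2 := by
    simp [laplacianSymbol]
  rw [hyukawa, ← fourier_yukawa hκ ξ, Real.fourier_eq, ← integral_smul_const, ← integral_smul]
  refine integral_congr_ae (ae_of_all _ fun v => ?_)
  dsimp only
  rw [add_sub_cancel_right, inner_add_left, neg_add, AddChar.map_add_eq_mul, mul_smul,
    smul_comm, Circle.smul_def, Circle.smul_def, Circle.smul_def, smul_assoc]

theorem inner_greenFun (hκ : 0 < κ.re) (a : Space) (b : F)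
    {T : Lp F 2 (volume : Measure Space) →ₗ.[ℂ] Lp F 2 (volume : Measure Space)}
    (hT : IsFourierMultiplier T laplacianSymbol) (f : T.domain)
    (hf : Integrable (𝓕 (f : Lp F 2 (volume : Measure Space)) : Lp F 2 (volume : Measure Space))) :
    inner ℂ (greenFun hκ a b) (T f - conj (-κ ^ 2) • (f : Lp F 2 (volume : Measure Space))) =
      inner ℂ b (contRep (f : Lp F 2 (volume : Measure Space)) a) := by
  rw [← Lp.inner_fourier_eq, L2.inner_def, contRep, Real.fourierInv_eq, ← integral_inner]
  · refine integral_congr_ae ?_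
    filter_upwards [fourier_greenFun hκ a b, hT.fourier_apply_sub_smul f (conj (-κ ^ 2))]
      with ξ hgreen hTf
    have hne : conj ((laplacianSymbol ξ : ℂ) + κ ^ 2) ≠ 0 :=
      (map_ne_zero conj).2 (laplacianSymbol_add_ne_zero hκ ξ)
    have hsymbol : (laplacianSymbol ξ : ℂ) - conj (-κ ^ 2) =
        conj ((laplacianSymbol ξ : ℂ) + κ ^ 2) := by simp
    have hchar : conj (𝐞 (-inner ℝ a ξ) : ℂ) = 𝐞 (inner ℝ ξ a) := by
      rw [← Circle.coe_inv_eq_conj, ← AddChar.map_neg_eq_inv, neg_neg, real_inner_comm]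
    rw [hgreen, hTf, Circle.smul_def, inner_smul_left, inner_smul_left, inner_smul_right,
      inner_smul_right, hchar, hsymbol, map_inv₀, inv_mul_cancel_left₀ hne]
  · simpa only [inner_neg_right, neg_neg] using (Real.fourierIntegral_convergent_iff (-a)).2 hf

end GreenFunction

variable {m n : ℕ} {κ : ℂ}

/-- The superposition `ξ ↦ ∑_j G(· - x_j) ξ_j` of Green functions of `-Δ + κ²`. -/
def greenMap (hκ : 0 < κ.re) (x : Fin m → Space) : BoundarySpace m n →ₗ[ℂ] L2 n :=
  ∑ j, greenFun hκ (x j) ∘ₗ PiLp.projₗ 2 _ j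

theorem greenMap_apply (hκ : 0 < κ.re) (x : Fin m → Space) (ξ : BoundarySpace m n) :
    greenMap hκ x ξ = ∑ j, greenFun hκ (x j) (ξ j) :=
  LinearMap.sum_apply _ _ _

theorem coeFn_greenMap (hκ : 0 < κ.re) (x : Fin m → Space) (ξ : BoundarySpace m n) :
    greenMap hκ x ξ =ᵐ[volume] fun y => ∑ j, yukawa κ (y - x j) • ξ j := by
  have h : ∀ᵐ y, ∀ j, greenFun hκ (x j) (ξ j) y = yukawa κ (y - x j) • ξ j :=
    ae_all_iff.2 fun j => coeFn_greenFun hκ (x j) (ξ j)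
  rw [greenMap_apply]
  filter_upwards [h, Lp.coeFn_finsetSum Finset.univ fun j => greenFun hκ (x j) (ξ j)]
    with y hgreen hsum
  rw [hsum, Finset.sum_apply]
  exact Finset.sum_congr rfl fun j _ => hgreen j

theorem inner_greenMap (hκ : 0 < κ.re) (x : Fin m → Space) (ξ : BoundarySpace m n) (f : W22 n) :
    inner ℂ (greenMap hκ x ξ) (negLaplacian n f - conj (-κ ^ 2) • (f : L2 n)) =
      inner ℂ ξ (pointValues x f) := by
  rw [greenMap_apply, sum_inner, PiLp.inner_apply]
  exact Finset.sum_congr rfl fun j _ => inner_greenFun hκ (x j) (ξ j)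
    isFourierMultiplier_freeOperator f (integrable_fourier_of_mem_W22 f.2)

end GreenFunctions

section BoundaryValues

open ComplexConjugate

theorem tendsto_norm_smul_of_tendsto_sub {V F : Type*} [NormedAddCommGroup V]
    [NormedAddCommGroup F] [NormedSpace ℝ F] {u : V → F} {a : V} {b c : F}
    (h : Tendsto (fun y => u y - ‖y - a‖⁻¹ • b) (𝓝[≠] a) (𝓝 c)) :
    Tendsto (fun y => ‖y - a‖ • u y) (𝓝[≠] a) (𝓝 b) := by
  have hnorm : Tendsto (fun y => ‖y - a‖) (𝓝[≠] a) (𝓝 0) :=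
    (tendsto_norm_sub_self a).mono_left nhdsWithin_le_nhds
  have hlim := (hnorm.smul h).add_const b
  rw [zero_smul, zero_add] at hlim
  refine hlim.congr' ?_
  filter_upwards [self_mem_nhdsWithin] with y hy
  have hne : ‖y - a‖ ≠ 0 := norm_ne_zero_iff.2 (sub_ne_zero.2 hy)
  rw [smul_sub, smul_inv_smul₀ hne, sub_add_cancel]

theorem eventuallyEq_nhdsNE_of_ae_eq {X Y : Type*} [TopologicalSpace X] [T1Space X]
    [MeasurableSpace X] [OpensMeasurableSpace X] {μ : Measure X} [μ.IsOpenPosMeasure]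
    [TopologicalSpace Y] [T2Space Y] {u v : X → Y} {s : Set X} (hs : s.Finite)
    (hu : ContinuousOn u sᶜ) (hv : ContinuousOn v sᶜ) (h : u =ᵐ[μ] v) (a : X) :
    u =ᶠ[𝓝[≠] a] v := by
  have heq : Set.EqOn u v sᶜ :=
    Measure.eqOn_open_of_ae_eq (ae_restrict_of_ae h) hs.isClosed.isOpen_compl hu hv
  have hnhds : (s \ {a})ᶜ ∈ 𝓝 a :=
    (hs.subset Set.sdiff_subset).isClosed.isOpen_compl.mem_nhds fun ha => ha.2 rfl
  filter_upwards [mem_nhdsWithin_of_mem_nhds hnhds, self_mem_nhdsWithin] with y hy hya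
  exact heq fun hys => hy ⟨hys, hya⟩

theorem tendsto_yukawa_sub (κ : ℂ) (a : Space) :
    Tendsto (fun y => yukawa κ (y - a) - (‖y - a‖ : ℂ)⁻¹ * (4 * Real.pi : ℂ)⁻¹) (𝓝[≠] a)
      (𝓝 (-κ / (4 * Real.pi))) := by
  have hexp : HasDerivAt (fun r : ℝ => Complex.exp (-κ * r)) (-κ) 0 := by
    simpa using (Complex.ofRealCLM.hasDerivAt (x := 0)).const_mul (-κ) |>.cexp
  have hnorm : Tendsto (fun y => ‖y - a‖) (𝓝[≠] a) (𝓝[≠] 0) := by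
    refine tendsto_nhdsWithin_iff.2
      ⟨(tendsto_norm_sub_self a).mono_left nhdsWithin_le_nhds, ?_⟩
    filter_upwards [self_mem_nhdsWithin] with y hy
    exact norm_ne_zero_iff.2 (sub_ne_zero.2 hy)
  refine ((hexp.tendsto_slope_zero.comp hnorm).div_const (4 * Real.pi : ℂ)).congr fun y => ?_
  simp only [Function.comp_apply, zero_add, yukawa, Complex.ofReal_zero, mul_zero,
    Complex.exp_zero, Complex.real_smul, Complex.ofReal_inv]
  rw [div_eq_mul_inv, div_eq_mul_inv, mul_inv]
  ring

theorem continuousAt_yukawa_sub (κ : ℂ) {a y : Space} (h : y ≠ a) :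
    ContinuousAt (fun y => yukawa κ (y - a)) y :=
  (continuousAt_yukawa κ (sub_ne_zero.2 h)).comp (f := (· - a)) (by fun_prop)

theorem tendsto_sum_yukawa_sub {ι F : Type*} [Fintype ι] [NormedAddCommGroup F]
    [NormedSpace ℂ F] (κ : ℂ) {x : ι → Space} (hx : Function.Injective x) (ξ : ι → F) (j : ι) :
    Tendsto (fun y => ∑ k, yukawa κ (y - x k) • ξ k -
        ((‖y - x j‖ : ℂ)⁻¹ * (4 * Real.pi : ℂ)⁻¹) • ξ j) (𝓝[≠] x j)
      (𝓝 ((-κ / (4 * Real.pi)) • ξ j + ∑ k, yukawa κ (x j - x k) • ξ k)) := by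
  classical
  have hsplit (y : Space) : ∑ k, yukawa κ (y - x k) • ξ k =
      yukawa κ (y - x j) • ξ j + ∑ k ∈ Finset.univ.erase j, yukawa κ (y - x k) • ξ k :=
    (Finset.add_sum_erase _ _ (Finset.mem_univ j)).symm
  simp only [hsplit, sub_self, yukawa_zero, zero_smul, zero_add, add_sub_right_comm, ← sub_smul]
  refine ((tendsto_yukawa_sub κ (x j)).smul_const (ξ j)).add
    (tendsto_finsetSum _ fun k hk => ?_)
  have hne : x j ≠ x k := hx.ne (Finset.ne_of_mem_erase hk).symm
  exact ((continuousAt_yukawa_sub κ hne).tendsto.mono_left nhdsWithin_le_nhds).smul_const (ξ k)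

theorem conj_yukawa (κ : ℂ) (y : Space) : conj (yukawa κ y) = yukawa (conj κ) y := by
  simp [yukawa, ← Complex.exp_conj, map_ofNat]

variable {m n : ℕ} {κ : ℂ} {x : Fin m → Space}

/-- The Weyl function at `-κ²`: the coefficient of the constant term of `∑_k G(· - x_k) ξ_k` at
each point `x_j`. The diagonal terms of the sum vanish, as `yukawa κ 0 = 0`. -/
def weylMap (κ : ℂ) (x : Fin m → Space) : BoundarySpace m n →ₗ[ℂ] BoundarySpace m n where
  toFun ξ := WithLp.toLp 2 fun j =>
    (-κ / (4 * Real.pi)) • ξ j + ∑ k, yukawa κ (x j - x k) • ξ k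
  map_add' ξ η := by
    ext1 j
    simp only [PiLp.add_apply, smul_add, Finset.sum_add_distrib, add_add_add_comm]
  map_smul' c ξ := by
    ext1 j
    simp only [PiLp.smul_apply, smul_add, Finset.smul_sum, RingHom.id_apply, smul_comm c]

theorem weylMap_apply (κ : ℂ) (x : Fin m → Space) (ξ : BoundarySpace m n) (j : Fin m) :
    weylMap κ x ξ j = (-κ / (4 * Real.pi)) • ξ j + ∑ k, yukawa κ (x j - x k) • ξ k := rfl

theorem inner_weylMap_left (κ : ℂ) (x : Fin m → Space) (ξ η : BoundarySpace m n) :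
    inner ℂ (weylMap κ x ξ) η = inner ℂ ξ (weylMap (conj κ) x η) := by
  simp only [PiLp.inner_apply (𝕜 := ℂ) (ι := Fin m), weylMap_apply, inner_add_left,
    inner_add_right, inner_smul_left, inner_smul_right, sum_inner, inner_sum,
    Finset.sum_add_distrib]
  congr 1
  · simp [map_ofNat]
  · rw [Finset.sum_comm]
    refine Finset.sum_congr rfl fun j _ => Finset.sum_congr rfl fun k _ => ?_
    rw [conj_yukawa, ← yukawa_neg, neg_sub]

theorem isSymmetric_weylMap (κ : ℝ) (x : Fin m → Space) :
    (weylMap (n := n) (κ : ℂ) x).IsSymmetric := fun ξ η => by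
  rw [inner_weylMap_left, Complex.conj_ofReal]

theorem hasBoundaryValues_add_greenMap (hκ : 0 < κ.re) (hx : Function.Injective x) (f : W22 n)
    (ξ : BoundarySpace m n) :
    HasBoundaryValues x ((f : L2 n) + greenMap hκ x ξ) ξ (pointValues x f + weylMap κ x ξ) := by
  have hint := integrable_fourier_of_mem_W22 f.2
  have hcont := continuous_contRep hint
  have hregular (j : Fin m) : Tendsto (fun y => contRep (f : L2 n) y +
      ∑ k, yukawa κ (y - x k) • ξ k - ‖y - x j‖⁻¹ • (4 * Real.pi)⁻¹ • ξ j) (𝓝[≠] x j)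
      (𝓝 ((pointValues x f + weylMap κ x ξ) j)) := by
    refine ((hcont.tendsto (x j)).mono_left nhdsWithin_le_nhds).add
      (tendsto_sum_yukawa_sub κ hx ξ j) |>.congr fun y => ?_
    rw [add_sub_assoc, smul_smul, ← Complex.coe_smul]
    push_cast
    rfl
  refine ⟨fun y => contRep (f : L2 n) y + ∑ k, yukawa κ (y - x k) • ξ k, ?_, fun y hy => ?_,
    fun j => (4 * Real.pi)⁻¹ • ξ j,
    fun j => ⟨tendsto_norm_smul_of_tendsto_sub (hregular j), ?_, hregular j⟩⟩
  · exact (Lp.coeFn_add _ _).trans ((coeFn_ae_eq_contRep hint).add (coeFn_greenMap hκ x ξ))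
  · refine (hcont.continuousAt.add (tendsto_finsetSum _ fun k _ => ?_)).continuousWithinAt
    exact (continuousAt_yukawa_sub κ fun h => hy ⟨k, h.symm⟩).smul continuousAt_const
  · rw [smul_inv_smul₀ (by positivity)]

theorem HasBoundaryValues.unique {f : L2 n} {h₀ h₁ k₀ k₁ : BoundarySpace m n}
    (h : HasBoundaryValues x f h₀ h₁) (k : HasBoundaryValues x f k₀ k₁) : h₀ = k₀ ∧ h₁ = k₁ := by
  obtain ⟨u, hfu, hu, ξ, hξ⟩ := h
  obtain ⟨v, hfv, hv, η, hη⟩ := k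
  have heq (j : Fin m) : u =ᶠ[𝓝[≠] x j] v :=
    eventuallyEq_nhdsNE_of_ae_eq (Set.finite_range x) hu hv (hfu.symm.trans hfv) (x j)
  have hne (j : Fin m) : (𝓝[≠] x j).NeBot := Module.punctured_nhds_neBot ℝ Space (x j)
  obtain rfl : ξ = η := by
    ext1 j
    exact tendsto_nhds_unique_of_eventuallyEq (hξ j).1 (hη j).1 (EventuallyEq.rfl.smul (heq j))
  constructor <;> ext1 j
  · rw [(hξ j).2.1, (hη j).2.1]
  · exact tendsto_nhds_unique_of_eventuallyEq (hξ j).2.2 (hη j).2.2 ((heq j).sub .rfl)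

theorem eq_zero_of_greenMap_mem_W22 (hκ : 0 < κ.re) (hx : Function.Injective x)
    {ξ : BoundarySpace m n} (h : greenMap hκ x ξ ∈ W22 n) : ξ = 0 := by
  have hsingular := hasBoundaryValues_add_greenMap hκ hx 0 ξ
  have hregular := hasBoundaryValues_add_greenMap hκ hx ⟨_, h⟩ 0
  rw [ZeroMemClass.coe_zero, zero_add] at hsingular
  rw [map_zero, add_zero] at hregular
  exact (hsingular.unique hregular).1

theorem isGreenMap_greenMap (hκ : 0 < κ.re) (hx : Function.Injective x) :
    IsGreenMap (freeOperator n) (pointValues x) (-κ ^ 2) (greenMap hκ x) where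
  inner_apply := inner_greenMap hκ x
  eq_zero_of_mem_domain _ := eq_zero_of_greenMap_mem_W22 hκ hx

theorem IsPointTriplet.isGreenTriplet
    {P : BoundaryTriplet (minimalOperator n x) (BoundarySpace m n)} (hP : IsPointTriplet x P)
    (hκ : 0 < κ.re) (hx : Function.Injective x) :
    P.IsGreenTriplet (S := freeOperator n) (pointValues x) (greenMap hκ x) (weylMap κ x) :=
  fun u f ξ hu => (hP u).unique (hu ▸ hasBoundaryValues_add_greenMap hκ hx f ξ)

end BoundaryValues

section PointTriplet

open ComplexConjugate

theorem neg_sq_mem_resolventSet_freeOperator {κ : ℂ} (n : ℕ) (hκ : 0 < κ.re) :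
    -κ ^ 2 ∈ resolventSet (freeOperator n) :=
  isFourierMultiplier_freeOperator.neg_sq_mem_resolventSet hκ

theorem conj_neg_sq_mem_resolventSet_freeOperator {κ : ℂ} (n : ℕ) (hκ : 0 < κ.re) :
    conj (-κ ^ 2) ∈ resolventSet (freeOperator n) := by
  rw [map_neg, map_pow]
  exact neg_sq_mem_resolventSet_freeOperator n (by rwa [Complex.conj_re])

variable {m n : ℕ} {κ : ℂ} {x : Fin m → Space}

theorem exists_isPointTriplet (n : ℕ) (hx : Function.Injective x) :
    ∃ P : BoundaryTriplet (minimalOperator n x) (BoundarySpace m n), IsPointTriplet x P := by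
  have hre : 0 < ((1 : ℝ) : ℂ).re := one_pos
  have hsq : -((1 : ℝ) : ℂ) ^ 2 = ((-1 : ℝ) : ℂ) := by norm_num
  have hA := isTraceRestriction_minimalOperator (n := n) x
  have hS := (isFourierMultiplier_freeOperator (n := n)).isFormalAdjoint
  have hc := neg_sq_mem_resolventSet_freeOperator n hre
  have hc' := conj_neg_sq_mem_resolventSet_freeOperator n hre
  have hG := isGreenMap_greenMap (n := n) hre hx
  obtain ⟨P, hP⟩ := (hsq ▸ hG).exists_isGreenTriplet hA hS (hsq ▸ hc) (isSymmetric_weylMap 1 x)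
  refine ⟨P, fun u => ?_⟩
  obtain ⟨f, ξ, hu⟩ := hG.exists_eq_add hA hS hc hc' u
  rw [(hP u f ξ hu).1, (hP u f ξ hu).2, hu]
  exact hasBoundaryValues_add_greenMap hre hx f ξ

namespace IsPointTriplet

variable {P : BoundaryTriplet (minimalOperator n x) (BoundarySpace m n)}

theorem A₀_eq (hP : IsPointTriplet x P) (hx : Function.Injective x) :
    P.A₀ = freeOperator n :=
  have hre : 0 < (1 : ℂ).re := one_pos
  (hP.isGreenTriplet hre hx).A₀_eq (isGreenMap_greenMap hre hx)
    (isTraceRestriction_minimalOperator x) isFourierMultiplier_freeOperator.isFormalAdjoint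
    (neg_sq_mem_resolventSet_freeOperator n hre) (conj_neg_sq_mem_resolventSet_freeOperator n hre)

theorem gammaField_neg_sq (hP : IsPointTriplet x P) (hx : Function.Injective x) (hκ : 0 < κ.re)
    (hz : -κ ^ 2 ∈ resolventSet P.A₀) : P.gammaField (-κ ^ 2) hz = greenMap hκ x :=
  (hP.isGreenTriplet hκ hx).gammaField_eq (isGreenMap_greenMap hκ hx)
    (isTraceRestriction_minimalOperator x) isFourierMultiplier_freeOperator.isFormalAdjoint
    (neg_sq_mem_resolventSet_freeOperator n hκ) (conj_neg_sq_mem_resolventSet_freeOperator n hκ) hz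

theorem weylFunction_neg_sq (hP : IsPointTriplet x P) (hx : Function.Injective x)
    (hκ : 0 < κ.re) (hz : -κ ^ 2 ∈ resolventSet P.A₀) :
    P.weylFunction (-κ ^ 2) hz = weylMap κ x :=
  (hP.isGreenTriplet hκ hx).weylFunction_eq (isGreenMap_greenMap hκ hx)
    (isTraceRestriction_minimalOperator x) isFourierMultiplier_freeOperator.isFormalAdjoint
    (neg_sq_mem_resolventSet_freeOperator n hκ) (conj_neg_sq_mem_resolventSet_freeOperator n hκ) hz

end IsPointTriplet

theorem exists_re_pos_eq_neg_sq {z : ℂ} (hz : -z ∈ Complex.slitPlane) :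
    ∃ κ : ℂ, 0 < κ.re ∧ z = -κ ^ 2 ∧ Complex.I * sqrtUpper z = -κ := by
  refine ⟨(-z) ^ (1 / 2 : ℂ), ?_, ?_, ?_⟩
  · have hpos : 0 < ‖-z‖ + (-z).re := by
      rcases Complex.mem_slitPlane_iff.1 hz with hre | him
      · positivity
      · exact neg_lt_iff_pos_add'.1 (abs_lt.1 (Complex.abs_re_lt_norm.2 him)).1
    rw [one_div, Complex.cpow_inv_two_re]
    positivity
  · rw [one_div, Complex.cpow_ofNat_inv_pow, neg_neg]
  · rw [sqrtUpper, ← mul_assoc, Complex.I_mul_I, neg_one_mul]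

theorem greenTilde_eq_yukawa {z : ℂ} (h : Complex.I * sqrtUpper z = -κ) (y : Space) :
    greenTilde z y = yukawa κ y := by
  rw [greenTilde, h]
  split_ifs with hy
  · rw [hy, yukawa_zero]
  · rfl

theorem weylMap_apply_apply {z : ℂ} (h : Complex.I * sqrtUpper z = -κ) (ξ : BoundarySpace m n)
    (j : Fin m) (s : Fin n) :
    weylMap κ x ξ j s = (weylBlock x z).mulVec (fun k => ξ k s) j := by
  simp [weylMap_apply, Matrix.mulVec, dotProduct, weylBlock, h, greenTilde_eq_yukawa h, add_mul,
    Finset.sum_add_distrib]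

end PointTriplet

end PointInteraction

end

theorem proposition4p2_general (m n : ℕ) (x : Fin m → PointInteraction.Space)
    (hx : Function.Injective x) :
    (∃ P : PointInteraction.BoundaryTriplet (PointInteraction.minimalOperator n x)
        (PointInteraction.BoundarySpace m n), PointInteraction.IsPointTriplet x P) ∧
    ∀ P : PointInteraction.BoundaryTriplet (PointInteraction.minimalOperator n x)
        (PointInteraction.BoundarySpace m n), PointInteraction.IsPointTriplet x P →
      ∀ z : ℂ, -z ∈ Complex.slitPlane →
        ∃ hz : z ∈ PointInteraction.resolventSet P.A₀,
          (∀ (ξ : PointInteraction.BoundarySpace m n) (s : Fin n),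
            (fun j => P.weylFunction z hz ξ j s) =
              (PointInteraction.weylBlock x z).mulVec fun k => ξ k s) ∧
          ∀ ξ : PointInteraction.BoundarySpace m n,
            P.gammaField z hz ξ =ᵐ[volume] fun y =>
              ∑ j, (Complex.exp (Complex.I * PointInteraction.sqrtUpper z * ‖y - x j‖) /
                (4 * Real.pi * ‖y - x j‖)) • ξ j := by
  refine ⟨PointInteraction.exists_isPointTriplet n hx, fun P hP z hz => ?_⟩
  obtain ⟨κ, hκ, rfl, hsqrt⟩ := PointInteraction.exists_re_pos_eq_neg_sq hz
  have hres : -κ ^ 2 ∈ PointInteraction.resolventSet P.A₀ := by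
    rw [hP.A₀_eq hx]
    exact PointInteraction.neg_sq_mem_resolventSet_freeOperator n hκ
  refine ⟨hres, fun ξ s => ?_, fun ξ => ?_⟩
  · ext j
    rw [hP.weylFunction_neg_sq hx hκ, PointInteraction.weylMap_apply_apply hsqrt]
  · rw [hP.gammaField_neg_sq hx hκ, hsqrt]
    exact PointInteraction.coeFn_greenMap hκ x ξ

theorem proposition4p2 (m n : ℕ) (x : Fin m → PointInteraction.Space)
    (hx : Function.Injective x) :
    (∃ P : PointInteraction.BoundaryTriplet (PointInteraction.minimalOperator n x)
        (PointInteraction.BoundarySpace m n), PointInteraction.IsPointTriplet x P) ∧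
    ∀ P : PointInteraction.BoundaryTriplet (PointInteraction.minimalOperator n x)
        (PointInteraction.BoundarySpace m n), PointInteraction.IsPointTriplet x P →
      ∀ z : ℂ, 0 < z.im →
        ∃ hz : z ∈ PointInteraction.resolventSet P.A₀,
          (∀ (ξ : PointInteraction.BoundarySpace m n) (s : Fin n),
            (fun j => P.weylFunction z hz ξ j s) =
              (PointInteraction.weylBlock x z).mulVec fun k => ξ k s) ∧
          ∀ ξ : PointInteraction.BoundarySpace m n,
            P.gammaField z hz ξ =ᵐ[volume] fun y =>
              ∑ j, (Complex.exp (Complex.I * PointInteraction.sqrtUpper z * ‖y - x j‖) /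
                (4 * Real.pi * ‖y - x j‖)) • ξ j :=
  (proposition4p2_general m n x hx).imp_right fun h P hP z hz =>
    h P hP z (Complex.mem_slitPlane_iff.2 (.inr (neg_ne_zero.2 hz.ne')))
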